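/- Let $Q=Q(q,p,\varepsilon)$ and $P=P(q,p,\varepsilon)$ be $C^\infty$ real functions on an open neighborhood of the origin of $\mathbb R^3$ with $\det\begin{pmatrix}Q_q&Q_p\\P_q&P_p\end{pmatrix}\equiv 1$ (a symplectic family), and let $F=\{(q,p,\varepsilon)\mid Q(q,p,\varepsilon)=q,\ P(q,p,\varepsilon)=p\}$ be its fixed point set. The origin is a rank-1-bifurcation point if $0\in F$, the Jacobian matrix of $(Q,P)$ with respect to $(q,p)$ at $0$ has the eigenvalue $1$ but is not the identity matrix, and the $2\times 3$ Jacobian matrix of $(Q-q,P-p)$ with respect to $(q,p,\varepsilon)$ at $0$ has rank $1$. Symplectic coordinates are given near $0$ by a local diffeomorphism $(q,p,\varepsilon)\mapsto(\tilde q,\tilde p,\varepsilon)$ fixing the origin and the parameter $\varepsilon$ with $\det\frac{\partial(\tilde q,\tilde p)}{\partial(q,p)}\equiv1$; they are called adapted if, for the family expressed in these coordinates, the $2\times3$ Jacobian matrix above equals $\begin{pmatrix}0&Q_p&0\\0&0&0\end{pmatrix}$ at $0$ with $Q_p\neq0$. A rank-1-bifurcation is regular if, in (some) adapted coordinates, the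 Hessian $\begin{pmatrix}P_{qq}&P_{q\varepsilon}\\P_{q\varepsilon}&P_{\varepsilon\varepsilon}\end{pmatrix}$ at $0$ is nondegenerate; it is then definite, or indefinite (a cross-bifurcation), if this Hessian is definite, respectively indefinite, and a cross-bifurcation is transcritical if moreover $P_{qq}\neq0$ at $0$ in adapted coordinates. Let the origin be a regular rank-1-bifurcation point. If the bifurcation is definite, then $F\cap U=\{0\}$ for some open neighborhood $U$ of $0$. If it is a cross-bifurcation, then there are an open neighborhood $U$ of $0$ and smooth embedded 1-dimensional submanifolds $A,B$ of $\mathbb R^3$ with $F\cap U=A\cup B$ and $A\cap B=\{0\}$, such that the tangent lines $a=T_0A$ and $b=T_0B$ are different; the intersection of the plane $a+b$ with the plane $\varepsilon=0$ is the eigenspace for the eigenvalue $1$ of the Jacobian matrix of $(Q,P)$ with respect to $(q,p)$ at $0$ (viewed as a subspace of the plane $\varepsilon=0$), which is 1-dimensional; and the bifurcation is transcritical if and only if this eigenspace is different from $a$ and from $b$. -/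

import Mathlib

open scoped ContDiff Topology Matrix

namespace SymplecticBifurcation

noncomputable section

/-- The `(q, p, ε)`-space. -/
abbrev Space : Type := ℝ × ℝ × ℝ

/-- Partial derivative with respect to `q`. -/
def dq (f : Space → ℝ) (x : Space) : ℝ := fderiv ℝ f x (1, 0, 0)

/-- Partial derivative with respect to `p`. -/
def dp (f : Space → ℝ) (x : Space) : ℝ := fderiv ℝ f x (0, 1, 0)

/-- Partial derivative with respect to `ε`. -/
def dε (f : Space → ℝ) (x : Space) : ℝ := fderiv ℝ f x (0, 0, 1)

/-- The Jacobian matrix of `(Q, P)` with respect to `(q, p)`. -/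
def jacobian (Q P : Space → ℝ) (x : Space) : Matrix (Fin 2) (Fin 2) ℝ :=
  !![dq Q x, dp Q x;
     dq P x, dp P x]

/-- The Jacobian matrix of `(Q - q, P - p)` with respect to `(q, p, ε)`. -/
def fixedPointJacobian (Q P : Space → ℝ) (x : Space) : Matrix (Fin 2) (Fin 3) ℝ :=
  !![dq Q x - 1, dp Q x,     dε Q x;
     dq P x,     dp P x - 1, dε P x]

/-- The Hessian matrix of `P` with respect to `(q, ε)`. -/
def hessianQE (P : Space → ℝ) (x : Space) : Matrix (Fin 2) (Fin 2) ℝ :=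
  !![dq (dq P) x, dε (dq P) x;
     dq (dε P) x, dε (dε P) x]

/-- A matrix whose quadratic form is (positive or negative) definite. -/
def IsDefiniteMatrix (M : Matrix (Fin 2) (Fin 2) ℝ) : Prop :=
  M.PosDef ∨ (-M).PosDef

/-- A matrix whose quadratic form takes positive and negative values. -/
def IsIndefiniteMatrix (M : Matrix (Fin 2) (Fin 2) ℝ) : Prop :=
  (∃ v : Fin 2 → ℝ, 0 < v ⬝ᵥ (M *ᵥ v)) ∧ (∃ w : Fin 2 → ℝ, w ⬝ᵥ (M *ᵥ w) < 0)

/-- A symplectic family: smooth functions `Q`, `P` on an open neighborhood of the origin of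
`(q, p, ε)`-space such that `(q, p) ↦ (Q, P)` is symplectic for each fixed `ε`.
(The values of `Q` and `P` outside `domain` are never used.) -/
structure SymplecticFamily where
  domain : Set Space
  isOpen_domain : IsOpen domain
  zero_mem_domain : (0 : Space) ∈ domain
  Q : Space → ℝ
  P : Space → ℝ
  contDiffOn_Q : ContDiffOn ℝ ∞ Q domain
  contDiffOn_P : ContDiffOn ℝ ∞ P domain
  det_jacobian : ∀ x ∈ domain, (jacobian Q P x).det = 1

/-- New symplectic coordinates near the origin, depending smoothly on `ε`: a local diffeomorphism
`(q, p, ε) ↦ (q', p', ε)` at the origin, fixing the origin, keeping the parameter `ε`, and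
preserving the area form `dq ∧ dp` for each fixed `ε`. -/
structure SymplecticCoordinates where
  chart : OpenPartialHomeomorph Space Space
  zero_mem_source : (0 : Space) ∈ chart.source
  map_zero : chart 0 = 0
  contDiffOn_chart : ContDiffOn ℝ ∞ chart chart.source
  contDiffOn_symm : ContDiffOn ℝ ∞ chart.symm chart.target
  parameter_eq : ∀ x ∈ chart.source, (chart x).2.2 = x.2.2
  det_jacobian : ∀ x ∈ chart.source,
    (jacobian (fun y => (chart y).1) (fun y => (chart y).2.1) x).det = 1

namespace SymplecticFamily

variable (F : SymplecticFamily)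

/-- The map `(q, p, ε) ↦ (Q, P, ε)`. -/
def toMap (x : Space) : Space := (F.Q x, F.P x, x.2.2)

/-- The total fixed point set of the family in `(q, p, ε)`-space. -/
def fixedPoints : Set Space := {x | x ∈ F.domain ∧ F.Q x = x.1 ∧ F.P x = x.2.1}

/-- The Jacobian matrix with respect to `(q, p)` at the origin. -/
def jacobianAtZero : Matrix (Fin 2) (Fin 2) ℝ := jacobian F.Q F.P 0

/-- The inclusion of the `(q, p)`-plane as the plane `ε = 0` of `(q, p, ε)`-space. -/
def planeInclusion : (Fin 2 → ℝ) →ₗ[ℝ] Space :=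
  (LinearMap.proj 0).prod ((LinearMap.proj 1).prod 0)

/-- The eigenspace of the Jacobian matrix at the origin for the eigenvalue `1`, as a subspace of
the plane `ε = 0` in `(q, p, ε)`-space. -/
def eigenspace : Submodule ℝ Space :=
  (Module.End.eigenspace (Matrix.toLin' F.jacobianAtZero) 1).map planeInclusion

/-- The origin is a rank-1-bifurcation point of the family. -/
structure IsRankOneBifurcation : Prop where
  map_zero : (0 : Space) ∈ F.fixedPoints
  hasEigenvalue : Module.End.HasEigenvalue (Matrix.toLin' F.jacobianAtZero) 1
  ne_one : F.jacobianAtZero ≠ 1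
  rank_eq : (fixedPointJacobian F.Q F.P 0).rank = 1

/-- The function `Q` expressed in new coordinates (for a family fixing the origin, this is the
first component of the conjugated map in a neighborhood of the origin). -/
def QIn (φ : SymplecticCoordinates) (y : Space) : ℝ :=
  (φ.chart (F.toMap (φ.chart.symm y))).1

/-- The function `P` expressed in new coordinates. -/
def PIn (φ : SymplecticCoordinates) (y : Space) : ℝ :=
  (φ.chart (F.toMap (φ.chart.symm y))).2.1

/-- Adapted coordinates: in these coordinates, the Jacobian matrix of `(Q - q, P - p)` at the
origin has `Q_p ≠ 0` as its only nonzero entry. -/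
def IsAdapted (φ : SymplecticCoordinates) : Prop :=
  ∃ c : ℝ, c ≠ 0 ∧ fixedPointJacobian (F.QIn φ) (F.PIn φ) 0 = !![0, c, 0; 0, 0, 0]

/-- The Hessian of `P` with respect to `(q, ε)` at the origin, in the given coordinates. -/
def hessianIn (φ : SymplecticCoordinates) : Matrix (Fin 2) (Fin 2) ℝ :=
  hessianQE (F.PIn φ) 0

/-- A rank-1-bifurcation is regular if the Hessian in adapted coordinates is nondegenerate. -/
def IsRegular : Prop :=
  F.IsRankOneBifurcation ∧ ∃ φ, F.IsAdapted φ ∧ (F.hessianIn φ).det ≠ 0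

/-- A definite (regular) rank-1-bifurcation. -/
def IsDefinite : Prop :=
  F.IsRankOneBifurcation ∧
    ∃ φ, F.IsAdapted φ ∧ (F.hessianIn φ).det ≠ 0 ∧ IsDefiniteMatrix (F.hessianIn φ)

/-- A cross-bifurcation, that is, an indefinite (regular) rank-1-bifurcation. -/
def IsCross : Prop :=
  F.IsRankOneBifurcation ∧
    ∃ φ, F.IsAdapted φ ∧ (F.hessianIn φ).det ≠ 0 ∧ IsIndefiniteMatrix (F.hessianIn φ)

/-- A transcritical bifurcation: a cross-bifurcation with `P_qq ≠ 0` in adapted coordinates. -/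
def IsTranscritical : Prop :=
  F.IsRankOneBifurcation ∧
    ∃ φ, F.IsAdapted φ ∧ (F.hessianIn φ).det ≠ 0 ∧ IsIndefiniteMatrix (F.hessianIn φ) ∧
      dq (dq (F.PIn φ)) 0 ≠ 0

end SymplecticFamily

/-- Smooth 1-dimensional (embedded) submanifolds of `(q, p, ε)`-space: near each of its points,
some diffeomorphism between open sets straightens the set to a piece of the first axis. -/
def IsSmoothCurve (A : Set Space) : Prop :=
  ∀ x ∈ A, ∃ e : OpenPartialHomeomorph Space Space,
    x ∈ e.source ∧ ContDiffOn ℝ ∞ e e.source ∧ ContDiffOn ℝ ∞ e.symm e.target ∧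
      ∀ y ∈ e.source, y ∈ A ↔ (e y).2 = 0

/-- The tangent space of a submanifold `A` at its point `x`, spanned by the velocities of smooth
curves in `A` through `x` (for a submanifold these velocities already form a subspace). -/
def tangentAt (A : Set Space) (x : Space) : Submodule ℝ Space :=
  Submodule.span ℝ {v | ∃ γ : ℝ → Space, ContDiffAt ℝ ∞ γ 0 ∧ γ 0 = x ∧
    (∀ᶠ t in 𝓝 (0 : ℝ), γ t ∈ A) ∧ HasDerivAt γ v 0}

/-- The plane `ε = 0`, that is, the `(q, p)`-plane in `(q, p, ε)`-space. -/
def parameterZeroPlane : Submodule ℝ Space :=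
  LinearMap.ker ((LinearMap.snd ℝ ℝ ℝ).comp (LinearMap.snd ℝ ℝ (ℝ × ℝ)))

end

end SymplecticBifurcation

/-! ### Smooth dependence of integrals on parameters, and Hadamard's lemma -/

section

open Filter Set

/-! In adapted coordinates `Q - q` has differential `c dp` with `c ≠ 0` at the origin, and `P - p`
has a critical point there. The surface `Q - q = 0` is therefore a graph over the `(q, ε)`-plane,
tangent to it at the origin, and fixed points correspond to zeros of the restriction `g(q, ε)` of `P
- p` to this surface (`exists_reduced_function`). Criticality of `P - p` removes the curvature of
the graph from the second derivative, so the Hessian of `g` is the `(q, ε)`-Hessian of `P`.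

If it is definite, completing the square isolates the zero of `g`. If it is indefinite, a Morse
factorization `g = α β` with independent differentials (`exists_factorization_of_hessian_det_neg`)
makes `(α, β, Q - q)` a chart in which the fixed point set is a union of two coordinate axes
(`exists_chart_of_indefinite`). These axes give the curves `A` and `B`.

The sum of their tangent lines is the kernel of `d(Q - q)`, that is, the plane `dp = 0`; it meets `ε
= 0` in the `q`-axis, which is the eigenspace. The entry `P_qq` vanishes exactly when the `q`-axis
is a null direction of the Hessian, hence tangent to one of the two branches. Transcriticality may
be witnessed by any adapted coordinates, so one implication is proved for all of them at once, by
differentiating `P - p` twice along a curve of fixed points (`dq_dq_PIn_eq_zero_of_curve`). -/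

/-- Induction on the order, differentiating under the integral sign. The codomain `F` is quantified
inside the statement because the derivative takes values in `E →L[ℝ] F`. -/
theorem ContDiff.parametric_intervalIntegral_aux {E : Type} [NormedAddCommGroup E]
    [NormedSpace ℝ E] [FiniteDimensional ℝ E] (n : ℕ) :
    ∀ {F : Type} [NormedAddCommGroup F] [NormedSpace ℝ F] [CompleteSpace F] {f : E → ℝ → F},
      ContDiff ℝ n (fun z : E × ℝ => f z.1 z.2) →
        ContDiff ℝ n (fun x => ∫ t in (0 : ℝ)..1, f x t) := by
  have : ProperSpace E := FiniteDimensional.proper ℝ E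
  induction n with
  | zero =>
    intro F _ _ _ f hf
    rw [Nat.cast_zero, contDiff_zero] at hf ⊢
    exact intervalIntegral.continuous_parametric_intervalIntegral_of_continuous' hf 0 1
  | succ n ih =>
    intro F _ _ _ f hf
    have hf1 : Differentiable ℝ (fun z : E × ℝ => f z.1 z.2) :=
      hf.differentiable (by simp)
    set f' : E → ℝ → (E →L[ℝ] F) := fun x t =>
      (fderiv ℝ (fun z : E × ℝ => f z.1 z.2) (x, t)).comp (ContinuousLinearMap.inl ℝ E ℝ) with hf'
    have hder : ∀ x t, HasFDerivAt (fun x => f x t) (f' x t) x := by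
      intro x t
      have h1 : HasFDerivAt (fun y : E => (y, t)) (ContinuousLinearMap.inl ℝ E ℝ) x :=
        hasFDerivAt_prodMk_left x t
      exact HasFDerivAt.comp (g := fun z : E × ℝ => f z.1 z.2) x (hf1 (x, t)).hasFDerivAt h1
    have hcd : ContDiff ℝ n (fun z : E × ℝ => f' z.1 z.2) := by
      have : ContDiff ℝ n (fderiv ℝ (fun z : E × ℝ => f z.1 z.2)) :=
        hf.fderiv_right (by norm_cast)
      exact this.clm_comp contDiff_const
    have hint : ∀ x, HasFDerivAt (fun x => ∫ t in (0 : ℝ)..1, f x t)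
        (∫ t in (0 : ℝ)..1, f' x t) x := by
      intro x
      -- Compactness supplies the constant that dominates the derivative near `x`.
      have hK : IsCompact (Metric.closedBall x 1 ×ˢ Icc (0 : ℝ) 1) :=
        (isCompact_closedBall x 1).prod isCompact_Icc
      obtain ⟨C, hC⟩ := hK.exists_bound_of_continuousOn hcd.continuous.continuousOn
      have hfc : ∀ x, Continuous (f x) := fun x =>
        hf.continuous.comp (continuous_const.prodMk continuous_id)
      have hfc' : ∀ x, Continuous (f' x) := fun x =>
        hcd.continuous.comp (continuous_const.prodMk continuous_id)
      refine (intervalIntegral.hasFDerivAt_integral_of_dominated_of_fderiv_le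
        (bound := fun _ => C) (s := Metric.closedBall x 1)
        (Metric.closedBall_mem_nhds x one_pos) ?_ ?_ ?_ ?_ ?_ ?_)
      · exact Eventually.of_forall fun y => (hfc y).aestronglyMeasurable
      · exact (hfc x).intervalIntegrable _ _
      · exact (hfc' x).aestronglyMeasurable
      · refine Eventually.of_forall fun t ht y hy => ?_
        rw [uIoc_of_le zero_le_one] at ht
        exact hC (y, t) ⟨hy, Ioc_subset_Icc_self ht⟩
      · exact intervalIntegrable_const
      · exact Eventually.of_forall fun t _ y _ => hder y t
    rw [Nat.cast_succ, contDiff_succ_iff_fderiv]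
    refine ⟨fun x => (hint x).differentiableAt, by simp, ?_⟩
    rw [funext fun x => (hint x).fderiv]
    exact ih hcd

theorem ContDiff.parametric_intervalIntegral {E F : Type} [NormedAddCommGroup E]
    [NormedSpace ℝ E] [FiniteDimensional ℝ E] [NormedAddCommGroup F] [NormedSpace ℝ F]
    [CompleteSpace F] {f : E → ℝ → F} (hf : ContDiff ℝ ∞ (fun z : E × ℝ => f z.1 z.2)) :
    ContDiff ℝ ∞ (fun x => ∫ t in (0 : ℝ)..1, f x t) := by
  rw [contDiff_infty] at hf ⊢
  exact fun n => ContDiff.parametric_intervalIntegral_aux n (hf n)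

/-- Hadamard's lemma. -/
theorem ContDiff.exists_eq_add_clm_apply {E F : Type} [NormedAddCommGroup E]
    [NormedSpace ℝ E] [FiniteDimensional ℝ E] [NormedAddCommGroup F] [NormedSpace ℝ F]
    [CompleteSpace F] {g : E → F} (hg : ContDiff ℝ ∞ g) :
    ∃ G : E → E →L[ℝ] F, ContDiff ℝ ∞ G ∧ ∀ x, g x = g 0 + G x x := by
  have hg' : ContDiff ℝ ∞ (fderiv ℝ g) := hg.fderiv_right (by simp)
  -- The average of the derivative over the segment from `0` to `x`.
  refine ⟨fun x => ∫ t in (0 : ℝ)..1, fderiv ℝ g (t • x),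
    ContDiff.parametric_intervalIntegral (hg'.comp (contDiff_snd.smul contDiff_fst)),
    fun x => ?_⟩
  have hc : Continuous fun t : ℝ => fderiv ℝ g (t • x) :=
    hg'.continuous.comp (by fun_prop)
  have h : ∀ t : ℝ, HasDerivAt (fun t : ℝ => g (t • x)) (fderiv ℝ g (t • x) x) t := by
    intro t
    have h1 : HasDerivAt (fun t : ℝ => t • x) x t := by
      simpa using (hasDerivAt_id t).smul_const x
    exact ((hg.differentiable (by simp)) (t • x)).hasFDerivAt.comp_hasDerivAt t h1
  change g x = g 0 + (∫ t in (0 : ℝ)..1, fderiv ℝ g (t • x)) x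
  rw [ContinuousLinearMap.intervalIntegral_apply (hc.intervalIntegrable _ _),
    intervalIntegral.integral_eq_sub_of_hasDerivAt (fun t _ => h t)
      ((hc.clm_apply continuous_const).intervalIntegrable _ _)]
  simp

/-! ### Cut-off, second-order chain rule and inverse function theorem -/

/-- A function that is smooth near a point agrees near it with a globally smooth function. -/
theorem exists_contDiff_eventuallyEq {E F : Type*} [NormedAddCommGroup E]
    [NormedSpace ℝ E] [FiniteDimensional ℝ E] [NormedAddCommGroup F] [NormedSpace ℝ F]
    {g : E → F} {x : E} (hg : ∀ᶠ y in 𝓝 x, ContDiffAt ℝ ∞ g y) :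
    ∃ f : E → F, ContDiff ℝ ∞ f ∧ f =ᶠ[𝓝 x] g := by
  obtain ⟨r, hr, hball⟩ := Metric.eventually_nhds_iff_ball.1 hg
  let χ : ContDiffBump x := ⟨r / 4, r / 2, by positivity, by linarith⟩
  refine ⟨fun y => χ y • g y, contDiff_iff_contDiffAt.2 fun y => ?_, ?_⟩
  · by_cases hy : y ∈ tsupport χ
    · rw [χ.tsupport_eq] at hy
      exact χ.contDiff.contDiffAt.smul
        (hball y (Metric.closedBall_subset_ball (by simp [χ]; linarith) hy))
    · refine (contDiffAt_const (c := (0 : F))).congr_of_eventuallyEq ?_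
      filter_upwards [notMem_tsupport_iff_eventuallyEq.1 hy] with z hz
      simp [hz]
  · filter_upwards [χ.eventuallyEq_one] with y hy
    simp [hy]

/-- The second derivative of a composition at a point where the outer function is critical. -/
theorem fderiv_fderiv_comp_of_fderiv_eq_zero {E F G : Type*} [NormedAddCommGroup E]
    [NormedSpace ℝ E] [NormedAddCommGroup F] [NormedSpace ℝ F]
    [NormedAddCommGroup G] [NormedSpace ℝ G] {f : F → G} {κ : E → F} {x : E}
    (hf : ContDiffAt ℝ 2 f (κ x)) (hκ : ContDiffAt ℝ 2 κ x) (h0 : fderiv ℝ f (κ x) = 0)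
    (v w : E) :
    fderiv ℝ (fderiv ℝ (f ∘ κ)) x v w =
      fderiv ℝ (fderiv ℝ f) (κ x) (fderiv ℝ κ x v) (fderiv ℝ κ x w) := by
  have h1 : fderiv ℝ (f ∘ κ) =ᶠ[𝓝 x] fun y => (fderiv ℝ f (κ y)).comp (fderiv ℝ κ y) := by
    filter_upwards [hκ.continuousAt.eventually (hf.eventually (by simp)),
      hκ.eventually (by simp)] with y hy hy'
    exact fderiv_comp y (hy.differentiableAt (by simp)) (hy'.differentiableAt (by simp))
  have hf' : HasFDerivAt (fderiv ℝ f) (fderiv ℝ (fderiv ℝ f) (κ x)) (κ x) :=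
    ((hf.fderiv_right (m := 1) (by norm_num)).differentiableAt (by simp)).hasFDerivAt
  have hκ' : HasFDerivAt (fderiv ℝ κ) (fderiv ℝ (fderiv ℝ κ) x) x :=
    ((hκ.fderiv_right (m := 1) (by norm_num)).differentiableAt (by simp)).hasFDerivAt
  -- The product rule also produces `Df` applied to the second derivative of `κ`; `h0` kills this
  -- term.
  have h2 := (hf'.comp x (hκ.differentiableAt (by simp)).hasFDerivAt).clm_comp hκ'
  rw [h1.fderiv_eq]
  erw [h2.fderiv]
  simp [h0]

/-- The inverse function theorem, with smoothness of the inverse on the whole target. -/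
theorem exists_openPartialHomeomorph_contDiffOn {E : Type*} [NormedAddCommGroup E]
    [NormedSpace ℝ E] [CompleteSpace E] {f : E → E} {x : E} {L : E ≃L[ℝ] E} {W : Set E}
    (hf : ∀ᶠ y in 𝓝 x, ContDiffAt ℝ ∞ f y) (hL : HasFDerivAt f (L : E →L[ℝ] E) x)
    (hW : W ∈ 𝓝 x) :
    ∃ e : OpenPartialHomeomorph E E, (∀ y, e y = f y) ∧ x ∈ e.source ∧ e.source ⊆ W ∧
      ContDiffOn ℝ ∞ e e.source ∧ ContDiffOn ℝ ∞ e.symm e.target := by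
  have hfx := hf.self_of_nhds
  let e₀ := hfx.toOpenPartialHomeomorph f hL (by simp)
  have h1 : ContinuousAt (fderiv ℝ f) x :=
    (hfx.fderiv_right (m := 0) (by simp)).continuousAt
  -- Invertibility of the derivative is an open condition. Shrinking the source to points where it
  -- holds makes the inverse smooth at every point of the target.
  have h2 : ∀ᶠ y in 𝓝 x, fderiv ℝ f y ∈ range ((↑) : (E ≃L[ℝ] E) → E →L[ℝ] E) := by
    refine h1.eventually (ContinuousLinearEquiv.isOpen.mem_nhds ?_)
    rw [hL.fderiv]
    exact ⟨L, rfl⟩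
  obtain ⟨V, hV, hVo, hxV⟩ := eventually_nhds_iff.1 ((hf.and h2).and hW)
  have hmem : ∀ y ∈ (e₀.restrOpen V hVo).source, y ∈ V := fun y hy => hy.2
  refine ⟨e₀.restrOpen V hVo, fun y => rfl,
    ⟨hfx.mem_toOpenPartialHomeomorph_source hL (by simp), hxV⟩,
    fun y hy => (hV y (hmem y hy)).2,
    fun y hy => (hV y (hmem y hy)).1.1.contDiffWithinAt, fun y hy => ?_⟩
  have hy' := (e₀.restrOpen V hVo).map_target hy
  obtain ⟨M, hM⟩ := (hV _ (hmem _ hy')).1.2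
  have hs := (hV _ (hmem _ hy')).1.1
  refine ((e₀.restrOpen V hVo).contDiffAt_symm hy (f₀' := M) ?_ hs).contDiffWithinAt
  rw [hM]
  exact (hs.differentiableAt (by simp)).hasFDerivAt

/-! ### Functions of two variables near a nondegenerate critical point -/

theorem fderiv_clm_apply_self {E F : Type*} [NormedAddCommGroup E] [NormedSpace ℝ E]
    [NormedAddCommGroup F] [NormedSpace ℝ F] {G : E → E →L[ℝ] F} (hG : Differentiable ℝ G)
    (x v : E) : fderiv ℝ (fun x => G x x) x v = G x v + fderiv ℝ G x v x := by
  have := ((hG x).hasFDerivAt.clm_apply (hasFDerivAt_id x)).fderiv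
  simp only [id] at this
  rw [this]
  simp

/-- Near a critical point with value zero, a function is a quadratic form with
smooth coefficients. -/
theorem exists_quadratic_coefficients {g : ℝ × ℝ → ℝ} (hg : ∀ᶠ y in 𝓝 0, ContDiffAt ℝ ∞ g y)
    (g0 : g 0 = 0) (dg0 : fderiv ℝ g 0 = 0) :
    ∃ a b c : ℝ × ℝ → ℝ, ContDiff ℝ ∞ a ∧ ContDiff ℝ ∞ b ∧ ContDiff ℝ ∞ c ∧
      (∀ᶠ y in 𝓝 0, g y = a y * y.1 ^ 2 + 2 * b y * y.1 * y.2 + c y * y.2 ^ 2) ∧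
      fderiv ℝ (fderiv ℝ g) 0 (1, 0) (1, 0) = 2 * a 0 ∧
      fderiv ℝ (fderiv ℝ g) 0 (1, 0) (0, 1) = 2 * b 0 ∧
      fderiv ℝ (fderiv ℝ g) 0 (0, 1) (1, 0) = 2 * b 0 ∧
      fderiv ℝ (fderiv ℝ g) 0 (0, 1) (0, 1) = 2 * c 0 := by
  obtain ⟨f, hf, hfg⟩ := exists_contDiff_eventuallyEq hg
  have hd : fderiv ℝ g =ᶠ[𝓝 0] fderiv ℝ f := hfg.symm.fderiv
  -- Hadamard's lemma twice: `f x = G₁ x x` and `G₁ x = G₂ x x`, so `f x = G₂ x x x`.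
  obtain ⟨G₁, hG₁, h₁⟩ := hf.exists_eq_add_clm_apply
  obtain ⟨G₂, hG₂, h₂⟩ := hG₁.exists_eq_add_clm_apply
  have hG₁d : Differentiable ℝ G₁ := hG₁.differentiable (by simp)
  have f0 : f 0 = 0 := hfg.self_of_nhds.trans g0
  have h₁' : f = fun x => G₁ x x := funext fun x => by rw [h₁ x, f0, zero_add]
  have hdf : ∀ x w, fderiv ℝ f x w = G₁ x w + fderiv ℝ G₁ x w x := by
    intro x w
    rw [h₁', fderiv_clm_apply_self hG₁d]
  have G₁0 : G₁ 0 = 0 := by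
    refine ContinuousLinearMap.ext fun w => ?_
    have := hdf 0 w
    rw [← hd.self_of_nhds, dg0] at this
    simpa using this.symm
  have h₂' : G₁ = fun x => G₂ x x := funext fun x => by rw [h₂ x, G₁0, zero_add]
  have dG₁ : ∀ v, fderiv ℝ G₁ 0 v = G₂ 0 v := by
    intro v
    rw [h₂', fderiv_clm_apply_self (hG₂.differentiable (by simp))]
    simp
  -- The bilinear form `G₂ 0` need not be symmetric; the second derivative is twice its
  -- symmetrization, which is why `b` below is an average.
  have hdd : ∀ v w, fderiv ℝ (fderiv ℝ g) 0 v w = G₂ 0 v w + G₂ 0 w v := by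
    intro v w
    have hdG : DifferentiableAt ℝ (fderiv ℝ G₁) 0 :=
      (hG₁.fderiv_right (m := 1) (by norm_cast)).differentiable (by simp) 0
    have hdiff : DifferentiableAt ℝ (fderiv ℝ f) 0 :=
      (hf.fderiv_right (m := 1) (by norm_cast)).differentiable (by simp) 0
    have e1 : fderiv ℝ (fun x => fderiv ℝ f x w) 0 v = fderiv ℝ (fderiv ℝ f) 0 v w := by
      rw [(hdiff.hasFDerivAt.clm_apply (hasFDerivAt_const w (0 : ℝ × ℝ))).fderiv]
      simp
    rw [hd.fderiv_eq, ← e1, funext fun x => hdf x w]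
    have e2 := ((hG₁d 0).hasFDerivAt.clm_apply (hasFDerivAt_const w (0 : ℝ × ℝ))).add
      ((hdG.hasFDerivAt.clm_apply (hasFDerivAt_const w (0 : ℝ × ℝ))).clm_apply
        (hasFDerivAt_id (0 : ℝ × ℝ)))
    erw [e2.fderiv]
    simp [dG₁]
  have hc : ∀ v w, ContDiff ℝ ∞ fun x => G₂ x v w := fun v w =>
    (hG₂.clm_apply contDiff_const).clm_apply contDiff_const
  refine ⟨fun x => G₂ x (1, 0) (1, 0), fun x => (G₂ x (1, 0) (0, 1) + G₂ x (0, 1) (1, 0)) / 2,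
    fun x => G₂ x (0, 1) (0, 1), hc _ _, ((hc _ _).add (hc _ _)).div_const 2, hc _ _, ?_, ?_, ?_,
    ?_, ?_⟩
  · filter_upwards [hfg] with y hy
    have : y = y.1 • ((1, 0) : ℝ × ℝ) + y.2 • ((0, 1) : ℝ × ℝ) := by ext <;> simp
    have e : f y = G₂ y y y := by rw [h₁', h₂']
    rw [← hy, e]
    generalize G₂ y = B
    conv_lhs => rw [this]
    simp only [map_add, map_smul, add_apply, smul_apply,
      smul_eq_mul]
    ring
  all_goals rw [hdd]; ring

/-- An isolated zero of a function with definite Hessian. -/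
theorem eventually_eq_zero_of_hessian_det_pos {g : ℝ × ℝ → ℝ}
    (hg : ∀ᶠ y in 𝓝 0, ContDiffAt ℝ ∞ g y) (g0 : g 0 = 0) (dg0 : fderiv ℝ g 0 = 0)
    (hdet : 0 < fderiv ℝ (fderiv ℝ g) 0 (1, 0) (1, 0) * fderiv ℝ (fderiv ℝ g) 0 (0, 1) (0, 1)
      - fderiv ℝ (fderiv ℝ g) 0 (1, 0) (0, 1) * fderiv ℝ (fderiv ℝ g) 0 (0, 1) (1, 0)) :
    ∀ᶠ y in 𝓝 0, g y = 0 → y = 0 := by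
  obtain ⟨a, b, c, ha, hb, hc, habc, e1, e2, e3, e4⟩ := exists_quadratic_coefficients hg g0 dg0
  rw [e1, e2, e3, e4] at hdet
  have hcont : Continuous fun y => a y * c y - b y ^ 2 :=
    (ha.continuous.mul hc.continuous).sub (hb.continuous.pow 2)
  have hpos : ∀ᶠ y in 𝓝 0, 0 < a y * c y - b y ^ 2 :=
    hcont.continuousAt.eventually (lt_mem_nhds (by linarith))
  filter_upwards [habc, hpos] with y hy hD hgy
  have ha0 : a y ≠ 0 := fun h => by rw [h] at hD; nlinarith [sq_nonneg (b y)]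
  -- Completing the square: the left side is `a y * g y`.
  have hsum : (a y * y.1 + b y * y.2) ^ 2 + (a y * c y - b y ^ 2) * y.2 ^ 2 = 0 := by
    rw [hgy] at hy
    linear_combination -a y * hy
  have h2 : y.2 = 0 := by
    by_contra h
    have := mul_pos hD (pow_pos (abs_pos.2 h) 2)
    rw [sq_abs] at this
    nlinarith [sq_nonneg (a y * y.1 + b y * y.2)]
  rw [h2] at hsum
  have h1 : a y * y.1 = 0 := by
    have : (a y * y.1) ^ 2 = 0 := by linear_combination hsum
    exact pow_eq_zero_iff (two_ne_zero) |>.1 this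
  exact Prod.ext ((mul_eq_zero.1 h1).resolve_left ha0) h2

/-- The Morse lemma in the indefinite case: a function of two variables with indefinite Hessian is
the product of two smooth functions with independent differentials. -/
theorem exists_factorization_of_hessian_det_neg {g : ℝ × ℝ → ℝ}
    (hg : ∀ᶠ y in 𝓝 0, ContDiffAt ℝ ∞ g y) (g0 : g 0 = 0) (dg0 : fderiv ℝ g 0 = 0)
    (hdet : fderiv ℝ (fderiv ℝ g) 0 (1, 0) (1, 0) * fderiv ℝ (fderiv ℝ g) 0 (0, 1) (0, 1)
      - fderiv ℝ (fderiv ℝ g) 0 (1, 0) (0, 1) * fderiv ℝ (fderiv ℝ g) 0 (0, 1) (1, 0) < 0) :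
    ∃ (α β : ℝ × ℝ → ℝ) (α₁ α₂ β₁ β₂ : ℝ), (∀ᶠ y in 𝓝 0, ContDiffAt ℝ ∞ α y) ∧
      (∀ᶠ y in 𝓝 0, ContDiffAt ℝ ∞ β y) ∧ α 0 = 0 ∧ β 0 = 0 ∧
      HasFDerivAt α (α₁ • ContinuousLinearMap.fst ℝ ℝ ℝ + α₂ • ContinuousLinearMap.snd ℝ ℝ ℝ) 0 ∧
      HasFDerivAt β (β₁ • ContinuousLinearMap.fst ℝ ℝ ℝ + β₂ • ContinuousLinearMap.snd ℝ ℝ ℝ) 0 ∧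
      α₁ * β₂ - α₂ * β₁ ≠ 0 ∧ (∀ᶠ y in 𝓝 0, g y = α y * β y) ∧
      (fderiv ℝ (fderiv ℝ g) 0 (1, 0) (1, 0) = 0 → α₁ = 0) := by
  obtain ⟨a, b, c, ha, hb, hc, habc, e1, e2, e3, e4⟩ := exists_quadratic_coefficients hg g0 dg0
  rw [e1, e2, e3, e4] at hdet
  set D : ℝ × ℝ → ℝ := fun y => b y ^ 2 - a y * c y with hD
  have hDc : ContDiff ℝ ∞ D := (hb.pow 2).sub (ha.mul hc)
  have hD0 : 0 < D 0 := by simp only [hD]; linarith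
  -- The roots `b ± √D` of `s² - 2bs + ac = 0` differ at the origin, so one of them is nonzero there
  -- and may serve as a denominator.
  obtain ⟨σ, hσ, hs0⟩ : ∃ σ : ℝ, σ ^ 2 = 1 ∧ b 0 + σ * √(D 0) ≠ 0 := by
    by_cases h : b 0 + √(D 0) = 0
    · refine ⟨-1, by norm_num, fun h' => ?_⟩
      have := Real.sqrt_pos.2 hD0
      linarith
    · exact ⟨1, by norm_num, by simpa using h⟩
  set s : ℝ × ℝ → ℝ := fun y => b y + σ * √(D y) with hs
  have hDev : ∀ᶠ y in 𝓝 0, 0 < D y := hDc.continuous.continuousAt.eventually (lt_mem_nhds hD0)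
  have hsev : ∀ᶠ y in 𝓝 0, ContDiffAt ℝ ∞ s y := by
    filter_upwards [hDev] with y hy
    exact hb.contDiffAt.add (contDiffAt_const.mul (hDc.contDiffAt.sqrt hy.ne'))
  have hsne : ∀ᶠ y in 𝓝 0, s y ≠ 0 :=
    hsev.self_of_nhds.continuousAt.eventually (isOpen_ne.mem_nhds hs0)
  have hsd := (hsev.self_of_nhds.differentiableAt (by simp)).hasFDerivAt
  have had := (ha.differentiable (by simp) 0).hasFDerivAt
  have hcd := (hc.differentiable (by simp) 0).hasFDerivAt
  have hssq : ∀ y, 0 < D y → s y ^ 2 = 2 * b y * s y - a y * c y := by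
    intro y hy
    have := Real.sq_sqrt hy.le
    simp only [hs]
    linear_combination σ ^ 2 * this + (D y) * hσ
  have hfst : HasFDerivAt (fun y : ℝ × ℝ => y.1) (ContinuousLinearMap.fst ℝ ℝ ℝ) 0 :=
    hasFDerivAt_fst
  have hsnd : HasFDerivAt (fun y : ℝ × ℝ => y.2) (ContinuousLinearMap.snd ℝ ℝ ℝ) 0 :=
    hasFDerivAt_snd
  -- The mixed coefficient of the product is `ac/s + s`, equal to `2b` by the equation for `s`. With
  -- this normalization `α₁ = a 0 / s 0`, so a vanishing `qq`-entry always shows up in the factor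
  -- `α`.
  refine ⟨fun y => a y / s y * y.1 + y.2, fun y => s y * y.1 + c y * y.2, a 0 / s 0, 1, s 0, c 0,
    ?_, ?_, by simp, by simp, ?_, ?_, ?_, ?_, ?_⟩
  · filter_upwards [hsev, hsne] with y hy hy'
    exact ((ha.contDiffAt.div hy hy').mul contDiffAt_fst).add contDiffAt_snd
  · filter_upwards [hsev] with y hy
    exact (hy.mul contDiffAt_fst).add (hc.contDiffAt.mul contDiffAt_snd)
  · have hq : DifferentiableAt ℝ (fun y => a y / s y) 0 :=
      (ha.contDiffAt.div hsev.self_of_nhds hs0).differentiableAt (by simp)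
    refine ((hq.hasFDerivAt.mul hfst).add hsnd).congr_fderiv ?_
    ext <;> simp
  · refine ((hsd.mul hfst).add (hcd.mul hsnd)).congr_fderiv ?_
    ext <;> simp
  -- Dependent differentials would give `ac = s²` at `0`, hence `s = b` and `D = 0`.
  · intro h
    have h1 : a 0 * c 0 - s 0 ^ 2 = 0 := by
      have hs0' : s 0 ≠ 0 := hs0
      field_simp at h
      linear_combination h
    have h2 := hssq 0 hD0
    have h3 : s 0 * (s 0 - b 0) = 0 := by linear_combination (1 / 2) * (h2 - h1)
    have h4 : σ * √(D 0) = 0 := by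
      have := (mul_eq_zero.1 h3).resolve_left hs0
      simp only [hs] at this
      linarith
    have h5 : √(D 0) ^ 2 = 0 := by
      linear_combination (σ * √(D 0)) * h4 - √(D 0) ^ 2 * hσ
    rw [Real.sq_sqrt hD0.le] at h5
    exact hD0.ne' h5
  · filter_upwards [habc, hsne, hDev] with y hy hsy hDy
    rw [hy]
    have := hssq y hDy
    field_simp
    linear_combination (-y.1 * y.2) * this
  · intro h
    rw [e1] at h
    have : a 0 = 0 := by linarith
    simp [this]

/-! ### Reduction of two equations in `(q, p, ε)` to one equation in `(q, ε)` -/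

namespace SymplecticBifurcation

theorem exists_continuousLinearEquiv_of_injective (M : Space →L[ℝ] Space)
    (hM : ∀ w, M w = 0 → w = 0) : ∃ L : Space ≃L[ℝ] Space, (L : Space →L[ℝ] Space) = M := by
  refine ⟨(LinearEquiv.ofInjectiveEndo (M : Space →ₗ[ℝ] Space)
    ((injective_iff_map_eq_zero _).2 hM)).toContinuousLinearEquiv, ?_⟩
  ext <;> rfl

/-- The inclusion `(q, ε) ↦ (q, 0, ε)`. -/
noncomputable def inclQE : ℝ × ℝ →L[ℝ] Space :=
  (ContinuousLinearMap.fst ℝ ℝ ℝ).prod ((0 : ℝ × ℝ →L[ℝ] ℝ).prod (ContinuousLinearMap.snd ℝ ℝ ℝ))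

/-- The projection `(q, p, ε) ↦ (q, ε)`. -/
noncomputable def projQE : Space →L[ℝ] ℝ × ℝ :=
  (ContinuousLinearMap.fst ℝ ℝ (ℝ × ℝ)).prod
    ((ContinuousLinearMap.snd ℝ ℝ ℝ).comp (ContinuousLinearMap.snd ℝ ℝ (ℝ × ℝ)))

@[simp] theorem inclQE_apply (v : ℝ × ℝ) : inclQE v = (v.1, 0, v.2) := rfl

@[simp] theorem projQE_apply (v : Space) : projQE v = (v.1, v.2.2) := rfl

/-- Solving `f₁ = 0` for `p` reduces the system `f₁ = f₂ = 0` to one equation in `(q, ε)`. -/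
theorem exists_reduced_function {f₁ f₂ : Space → ℝ} {c : ℝ} (hc : c ≠ 0)
    (hf₁ : ∀ᶠ y in 𝓝 0, ContDiffAt ℝ ∞ f₁ y) (hf₂ : ∀ᶠ y in 𝓝 0, ContDiffAt ℝ ∞ f₂ y)
    (h₁ : f₁ 0 = 0) (h₂ : f₂ 0 = 0) (hd₁ : ∀ w, fderiv ℝ f₁ 0 w = c * w.2.1)
    (hd₂ : fderiv ℝ f₂ 0 = 0) :
    ∃ g : ℝ × ℝ → ℝ, (∀ᶠ y in 𝓝 0, ContDiffAt ℝ ∞ g y) ∧ g 0 = 0 ∧ fderiv ℝ g 0 = 0 ∧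
      (∀ v w, fderiv ℝ (fderiv ℝ g) 0 v w =
        fderiv ℝ (fderiv ℝ f₂) 0 (v.1, 0, v.2) (w.1, 0, w.2)) ∧
      (∀ᶠ y in 𝓝 (0 : Space), f₁ y = 0 → f₂ y = g (y.1, y.2.2)) ∧
      ∀ᶠ y in 𝓝 (0 : Space), f₁ y = 0 → (y.1, y.2.2) = (0 : ℝ × ℝ) → y = 0 := by
  have hd₁' := (hf₁.self_of_nhds.differentiableAt (by simp)).hasFDerivAt
  obtain ⟨L, hL⟩ := exists_continuousLinearEquiv_of_injective
    ((ContinuousLinearMap.fst ℝ ℝ (ℝ × ℝ)).prod ((fderiv ℝ f₁ 0).prod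
      ((ContinuousLinearMap.snd ℝ ℝ ℝ).comp (ContinuousLinearMap.snd ℝ ℝ (ℝ × ℝ))))) (by
    rintro ⟨x, y, z⟩ h
    have h1 : x = 0 := congrArg (fun w : Space => w.1) h
    have h2 : fderiv ℝ f₁ 0 (x, y, z) = 0 := congrArg (fun w : Space => w.2.1) h
    have h3 : z = 0 := congrArg (fun w : Space => w.2.2) h
    rw [hd₁] at h2
    have h4 : y = 0 := (mul_eq_zero.1 h2).resolve_left hc
    simp [h1, h3, h4])
  have hLa : ∀ w, L w = (w.1, c * w.2.1, w.2.2) := by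
    intro w
    have : (L : Space →L[ℝ] Space) w = (w.1, fderiv ℝ f₁ 0 w, w.2.2) := by rw [hL]; rfl
    rwa [hd₁] at this
  obtain ⟨e, he, h0, -, hes, het⟩ := exists_openPartialHomeomorph_contDiffOn
    (f := fun y : Space => (y.1, f₁ y, y.2.2)) (x := 0) (L := L) (W := univ)
    (by
      filter_upwards [hf₁] with y hy
      exact contDiffAt_fst.prodMk (hy.prodMk (contDiffAt_snd.comp y contDiffAt_snd)))
    (by
      rw [hL]
      exact hasFDerivAt_fst.prodMk (hd₁'.prodMk (hasFDerivAt_snd.comp _ hasFDerivAt_snd)))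
    univ_mem
  have he0 : e 0 = 0 := by rw [he]; simp [h₁]
  have h0t : (0 : Space) ∈ e.target := by rw [← he0]; exact e.map_source h0
  have hes0 : e.symm 0 = 0 := by
    have := e.left_inv h0
    rwa [he0] at this
  have hinv : HasFDerivAt e (L : Space →L[ℝ] Space) 0 := by
    rw [funext he, hL]
    exact hasFDerivAt_fst.prodMk (hd₁'.prodMk (hasFDerivAt_snd.comp _ hasFDerivAt_snd))
  have hsymm : HasFDerivAt e.symm (L.symm : Space →L[ℝ] Space) 0 := by
    refine e.hasFDerivAt_symm h0t ?_
    rwa [hes0]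
  -- Since `e` is `(q, f₁, ε)`, this parametrizes the surface `f₁ = 0` by `(q, ε)`; the reduced
  -- function is `f₂ ∘ κ`.
  set κ : ℝ × ℝ → Space := fun u => e.symm (inclQE u) with hκ
  have hκ0 : κ 0 = 0 := by simp only [hκ, map_zero, hes0]
  have hκd : HasFDerivAt κ ((L.symm : Space →L[ℝ] Space).comp inclQE) 0 := by
    refine HasFDerivAt.comp (g := e.symm) 0 ?_ inclQE.hasFDerivAt
    rwa [map_zero]
  have hκs : ∀ᶠ u in 𝓝 0, ContDiffAt ℝ ∞ κ u := by
    have : ∀ᶠ u in 𝓝 (0 : ℝ × ℝ), inclQE u ∈ e.target :=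
      inclQE.continuous.continuousAt.eventually (by
        rw [map_zero]; exact e.open_target.mem_nhds h0t)
    filter_upwards [this] with u hu
    exact (het.contDiffAt (e.open_target.mem_nhds hu)).comp u inclQE.contDiff.contDiffAt
  have hκe : ∀ v, fderiv ℝ κ 0 v = (v.1, 0, v.2) := by
    intro v
    rw [hκd.fderiv]
    change L.symm (inclQE v) = _
    rw [L.symm_apply_eq]
    simp [hLa]
  have hsrc : ∀ᶠ y in 𝓝 (0 : Space), y ∈ e.source := e.open_source.mem_nhds h0
  refine ⟨f₂ ∘ κ, ?_, by simp [hκ0, h₂], ?_, ?_, ?_, ?_⟩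
  · have := hκs.self_of_nhds.continuousAt.eventually (p := fun y => ContDiffAt ℝ ∞ f₂ y)
      (by rwa [hκ0])
    filter_upwards [this, hκs] with u hu hu'
    exact hu.comp u hu'
  · rw [fderiv_comp (𝕜 := ℝ) _ (by
      rw [hκ0]; exact hf₂.self_of_nhds.differentiableAt (by simp)) hκd.differentiableAt, hκ0, hd₂]
    simp
  · intro v w
    rw [fderiv_fderiv_comp_of_fderiv_eq_zero, hκ0, hκe, hκe]
    · rw [hκ0]; exact hf₂.self_of_nhds.of_le (by norm_cast)
    · exact hκs.self_of_nhds.of_le (by norm_cast)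
    · rw [hκ0, hd₂]
  · filter_upwards [hsrc] with y hy h
    have h3 : inclQE (y.1, y.2.2) = e y := by rw [he, h]; rfl
    simp only [Function.comp, hκ]
    rw [h3, e.left_inv hy]
  · filter_upwards [hsrc] with y hy h h'
    have h3 : e y = 0 := by
      rw [he, h]
      simp only [Prod.mk_eq_zero] at h' ⊢
      simp [h'.1, h'.2]
    rw [← e.left_inv hy, h3, hes0]

/-- Local uniqueness of the solution of `f₁ = f₂ = 0` when the reduced Hessian is definite. -/
theorem eventually_eq_zero_of_definite {f₁ f₂ : Space → ℝ} {c : ℝ} (hc : c ≠ 0)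
    (hf₁ : ∀ᶠ y in 𝓝 0, ContDiffAt ℝ ∞ f₁ y) (hf₂ : ∀ᶠ y in 𝓝 0, ContDiffAt ℝ ∞ f₂ y)
    (h₁ : f₁ 0 = 0) (h₂ : f₂ 0 = 0) (hd₁ : ∀ w, fderiv ℝ f₁ 0 w = c * w.2.1)
    (hd₂ : fderiv ℝ f₂ 0 = 0)
    (hdet : 0 < fderiv ℝ (fderiv ℝ f₂) 0 (1, 0, 0) (1, 0, 0) *
        fderiv ℝ (fderiv ℝ f₂) 0 (0, 0, 1) (0, 0, 1) -
      fderiv ℝ (fderiv ℝ f₂) 0 (1, 0, 0) (0, 0, 1) *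
        fderiv ℝ (fderiv ℝ f₂) 0 (0, 0, 1) (1, 0, 0)) :
    ∀ᶠ y in 𝓝 0, f₁ y = 0 → f₂ y = 0 → y = 0 := by
  obtain ⟨g, hg, g0, dg0, hgH, hfg, huniq⟩ := exists_reduced_function hc hf₁ hf₂ h₁ h₂ hd₁ hd₂
  have hz := eventually_eq_zero_of_hessian_det_pos hg g0 dg0 (by simpa only [hgH] using hdet)
  have hz' : ∀ᶠ y in 𝓝 (0 : Space), g (projQE y) = 0 → projQE y = 0 :=
    projQE.continuous.continuousAt.eventually (by rwa [map_zero])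
  filter_upwards [hfg, huniq, hz'] with y hy1 hy2 hy3 h h'
  exact hy2 h (hy3 ((hy1 h).symm.trans h'))

/-- A chart straightening the solutions of `f₁ = f₂ = 0` to two coordinate axes when the reduced
Hessian is indefinite. -/
theorem exists_chart_of_indefinite {f₁ f₂ : Space → ℝ} {c : ℝ} (hc : c ≠ 0)
    (hf₁ : ∀ᶠ y in 𝓝 0, ContDiffAt ℝ ∞ f₁ y) (hf₂ : ∀ᶠ y in 𝓝 0, ContDiffAt ℝ ∞ f₂ y)
    (h₁ : f₁ 0 = 0) (h₂ : f₂ 0 = 0) (hd₁ : ∀ w, fderiv ℝ f₁ 0 w = c * w.2.1)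
    (hd₂ : fderiv ℝ f₂ 0 = 0)
    (hdet : fderiv ℝ (fderiv ℝ f₂) 0 (1, 0, 0) (1, 0, 0) *
        fderiv ℝ (fderiv ℝ f₂) 0 (0, 0, 1) (0, 0, 1) -
      fderiv ℝ (fderiv ℝ f₂) 0 (1, 0, 0) (0, 0, 1) *
        fderiv ℝ (fderiv ℝ f₂) 0 (0, 0, 1) (1, 0, 0) < 0)
    {W : Set Space} (hW : W ∈ 𝓝 0) :
    ∃ (e : OpenPartialHomeomorph Space Space) (M : Space ≃L[ℝ] Space),
      (0 : Space) ∈ e.source ∧ e.source ⊆ W ∧ e 0 = 0 ∧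
      ContDiffOn ℝ ∞ e e.source ∧ ContDiffOn ℝ ∞ e.symm e.target ∧
      HasFDerivAt e (M : Space →L[ℝ] Space) 0 ∧ (∀ w, (M w).2.2 = c * w.2.1) ∧
      (∀ y ∈ e.source, f₁ y = 0 ∧ f₂ y = 0 ↔ ((e y).1 = 0 ∨ (e y).2.1 = 0) ∧ (e y).2.2 = 0) ∧
      (fderiv ℝ (fderiv ℝ f₂) 0 (1, 0, 0) (1, 0, 0) = 0 → ∀ x, (M (x, 0, 0)).1 = 0) := by
  obtain ⟨g, hg, g0, dg0, hgH, hfg, -⟩ := exists_reduced_function hc hf₁ hf₂ h₁ h₂ hd₁ hd₂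
  obtain ⟨α, β, α₁, α₂, β₁, β₂, hα, hβ, α0, β0, hαd, hβd, hind, hαβ, hα₁⟩ :=
    exists_factorization_of_hessian_det_neg hg g0 dg0 (by simpa only [hgH] using hdet)
  have hproj : Tendsto projQE (𝓝 0) (𝓝 0) := by
    have := projQE.continuous.tendsto 0
    rwa [map_zero] at this
  have hd₁' := (hf₁.self_of_nhds.differentiableAt (by simp)).hasFDerivAt
  have hαp : HasFDerivAt (fun y => α (projQE y)) _ 0 :=
    HasFDerivAt.comp (g := α) (0 : Space) (by rwa [map_zero]) projQE.hasFDerivAt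
  have hβp : HasFDerivAt (fun y => β (projQE y)) _ 0 :=
    HasFDerivAt.comp (g := β) (0 : Space) (by rwa [map_zero]) projQE.hasFDerivAt
  have hder := hαp.prodMk (hβp.prodMk hd₁')
  obtain ⟨M, hM⟩ := exists_continuousLinearEquiv_of_injective
    (((α₁ • ContinuousLinearMap.fst ℝ ℝ ℝ + α₂ • ContinuousLinearMap.snd ℝ ℝ ℝ).comp projQE).prod
      (((β₁ • ContinuousLinearMap.fst ℝ ℝ ℝ + β₂ • ContinuousLinearMap.snd ℝ ℝ ℝ).comp
        projQE).prod (fderiv ℝ f₁ 0))) (fun w h => by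
    have h1 : α₁ * w.1 + α₂ * w.2.2 = 0 := congrArg (fun w : Space => w.1) h
    have h2 : β₁ * w.1 + β₂ * w.2.2 = 0 := congrArg (fun w : Space => w.2.1) h
    have h3 : fderiv ℝ f₁ 0 w = 0 := congrArg (fun w : Space => w.2.2) h
    rw [hd₁] at h3
    have h4 : w.2.1 = 0 := (mul_eq_zero.1 h3).resolve_left hc
    have h5 : w.1 = 0 := (mul_eq_zero.1 (show (α₁ * β₂ - α₂ * β₁) * w.1 = 0 by
      linear_combination β₂ * h1 - α₂ * h2)).resolve_left hind
    have h6 : w.2.2 = 0 := (mul_eq_zero.1 (show (α₁ * β₂ - α₂ * β₁) * w.2.2 = 0 by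
      linear_combination α₁ * h2 - β₁ * h1)).resolve_left hind
    exact Prod.ext h5 (Prod.ext h4 h6))
  have hMa : ∀ w, M w = (α₁ * w.1 + α₂ * w.2.2, β₁ * w.1 + β₂ * w.2.2, fderiv ℝ f₁ 0 w) := by
    intro w
    change (M : Space →L[ℝ] Space) w = _
    rw [hM]
    rfl
  rw [← hM] at hder
  -- The chart is `(α, β, f₁)`. Its source is cut down to where the reduction and the factorization
  -- both hold, so that the description of the zero set is valid at each of its points.
  obtain ⟨e, he, h0, heW, hes, het⟩ := exists_openPartialHomeomorph_contDiffOn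
    (W := W ∩ {y | (f₁ y = 0 → f₂ y = g (y.1, y.2.2)) ∧
      g (projQE y) = α (projQE y) * β (projQE y)})
    (by
      filter_upwards [hf₁, hproj.eventually hα, hproj.eventually hβ] with y hy hyα hyβ
      exact (hyα.comp y projQE.contDiff.contDiffAt).prodMk
        ((hyβ.comp y projQE.contDiff.contDiffAt).prodMk hy)) hder
    (inter_mem hW (hfg.and (hproj.eventually hαβ)))
  refine ⟨e, M, h0, fun y hy => (heW hy).1, ?_, hes, het, ?_, ?_, ?_, ?_⟩
  · rw [he]
    simp only [map_zero, α0, β0, h₁]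
    rfl
  · rwa [funext he]
  · intro w
    rw [hMa]
    exact hd₁ w
  · intro y hy
    obtain ⟨-, hy1, hy2⟩ := heW hy
    rw [he]
    change _ ↔ (α (projQE y) = 0 ∨ β (projQE y) = 0) ∧ f₁ y = 0
    rw [← mul_eq_zero, ← hy2, and_comm]
    exact and_congr_left fun h => by rw [hy1 h]; rfl
  · intro h x
    rw [hMa, hα₁ (by simpa only [hgH] using h)]
    simp

/-! ### Curves cut out as a chart axis, and their tangent lines -/

section Curves

variable {Θ : OpenPartialHomeomorph Space Space} {N : Space ≃L[ℝ] Space}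

theorem isSmoothCurve_of_chart (hs : ContDiffOn ℝ ∞ Θ Θ.source)
    (ht : ContDiffOn ℝ ∞ Θ.symm Θ.target) :
    IsSmoothCurve {x | x ∈ Θ.source ∧ (Θ x).2 = 0} :=
  fun _ hx => ⟨Θ, hx.1, hs, ht, fun _ hy => and_iff_right hy⟩

/-- Along a curve in the set, the last two chart coordinates vanish near time `0`, so they vanish on
its velocity. Conversely, the inverse chart carries the first axis to a curve realizing the
generator. -/
theorem tangentAt_eq_span (h0 : (0 : Space) ∈ Θ.source) (hz : Θ 0 = 0)
    (ht : ContDiffOn ℝ ∞ Θ.symm Θ.target) (hN : HasFDerivAt Θ (N : Space →L[ℝ] Space) 0) :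
    tangentAt {x | x ∈ Θ.source ∧ (Θ x).2 = 0} 0 = Submodule.span ℝ {N.symm (1, 0, 0)} := by
  have h0t : (0 : Space) ∈ Θ.target := by rw [← hz]; exact Θ.map_source h0
  have hsz : Θ.symm 0 = 0 := by
    have := Θ.left_inv h0
    rwa [hz] at this
  apply le_antisymm
  · refine Submodule.span_le.2 ?_
    rintro v ⟨γ, -, hγ0, hγA, hγ⟩
    have hd : HasDerivAt (fun t => (Θ (γ t)).2) (N v).2 0 := by
      have h1 : HasDerivAt (fun t => Θ (γ t)) (N v) 0 :=
        HasFDerivAt.comp_hasDerivAt (l := Θ) (l' := (N : Space →L[ℝ] Space)) 0 (by rwa [hγ0]) hγ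
      exact (hasFDerivAt_snd (p := Θ (γ 0))).comp_hasDerivAt (0 : ℝ) h1
    have hd' : HasDerivAt (fun t => (Θ (γ t)).2) 0 0 :=
      (hasDerivAt_const (0 : ℝ) (0 : ℝ × ℝ)).congr_of_eventuallyEq (hγA.mono fun t ht => ht.2)
    have hv : (N v).2 = 0 := hd.unique hd'
    refine Submodule.mem_span_singleton.2 ⟨(N v).1, ?_⟩
    rw [← map_smul, N.symm_apply_eq]
    ext <;> simp [hv]
  · refine Submodule.span_le.2 (singleton_subset_iff.2 (Submodule.subset_span ?_))
    let ι : ℝ →L[ℝ] Space := ContinuousLinearMap.inl ℝ ℝ (ℝ × ℝ)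
    have hι0 : ι 0 = 0 := map_zero ι
    have hιt : ∀ᶠ t in 𝓝 (0 : ℝ), ι t ∈ Θ.target :=
      ι.continuous.continuousAt.eventually (by rw [hι0]; exact Θ.open_target.mem_nhds h0t)
    refine ⟨fun t => Θ.symm (ι t), ?_, by simp only [hι0, hsz], ?_, ?_⟩
    · exact ContDiffAt.comp (g := Θ.symm) 0
        (by rw [hι0]; exact ht.contDiffAt (Θ.open_target.mem_nhds h0t)) ι.contDiff.contDiffAt
    · filter_upwards [hιt] with t h
      refine ⟨Θ.map_target h, ?_⟩
      rw [Θ.right_inv h]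
      rfl
    · have hsymm : HasFDerivAt Θ.symm (N.symm : Space →L[ℝ] Space) 0 :=
        Θ.hasFDerivAt_symm h0t (by rwa [hsz])
      have hι : HasDerivAt ι (1, 0, 0) 0 := ι.hasDerivAt
      exact HasFDerivAt.comp_hasDerivAt (l := Θ.symm) (l' := (N.symm : Space →L[ℝ] Space)) 0 (by rwa [hι0]) hι

theorem mem_span_symm_iff (v : Space) :
    v ∈ Submodule.span ℝ {N.symm (1, 0, 0)} ↔ (N v).2 = 0 := by
  rw [Submodule.mem_span_singleton]
  constructor
  · rintro ⟨a, rfl⟩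
    simp
  · intro hv
    refine ⟨(N v).1, ?_⟩
    rw [← map_smul, N.symm_apply_eq]
    ext <;> simp [hv]

theorem finrank_span_symm :
    Module.finrank ℝ (Submodule.span ℝ {N.symm ((1, 0, 0) : Space)}) = 1 :=
  finrank_span_singleton (by simp)

end Curves

/-- Exchange of the first two coordinates. -/
noncomputable def swapQP : Space ≃L[ℝ] Space :=
  LinearEquiv.toContinuousLinearEquiv
    { toFun := fun x => (x.2.1, x.1, x.2.2)
      invFun := fun x => (x.2.1, x.1, x.2.2)
      map_add' := fun _ _ => rfl
      map_smul' := fun _ _ => rfl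
      left_inv := fun _ => rfl
      right_inv := fun _ => rfl }

@[simp] theorem swapQP_apply (x : Space) : swapQP x = (x.2.1, x.1, x.2.2) := rfl

/-! ### Partial derivatives and coordinate changes -/

theorem fderiv_apply_eq (f : Space → ℝ) (x w : Space) :
    fderiv ℝ f x w = w.1 * dq f x + w.2.1 * dp f x + w.2.2 * dε f x := by
  have : w = w.1 • (1, 0, 0) + w.2.1 • (0, 1, 0) + w.2.2 • ((0, 0, 1) : Space) := by
    ext <;> simp
  conv_lhs => rw [this]
  simp only [map_add, map_smul, smul_eq_mul]
  rfl

theorem fderiv_fderiv_apply {f : Space → ℝ} {x : Space} (hf : ContDiffAt ℝ ∞ f x) (v w : Space) :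
    fderiv ℝ (fun y => fderiv ℝ f y w) x v = fderiv ℝ (fderiv ℝ f) x v w := by
  have hd : DifferentiableAt ℝ (fderiv ℝ f) x :=
    (hf.fderiv_right (m := 1) (by norm_cast)).differentiableAt (by simp)
  rw [(hd.hasFDerivAt.clm_apply (hasFDerivAt_const w x)).fderiv]
  simp

namespace SymplecticCoordinates

variable (φ : SymplecticCoordinates)

theorem zero_mem_target : (0 : Space) ∈ φ.chart.target := by
  rw [← φ.map_zero]
  exact φ.chart.map_source φ.zero_mem_source

theorem symm_zero : φ.chart.symm 0 = 0 := by
  have := φ.chart.left_inv φ.zero_mem_source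
  rwa [φ.map_zero] at this

theorem contDiffAt_chart {x : Space} (hx : x ∈ φ.chart.source) : ContDiffAt ℝ ∞ φ.chart x :=
  φ.contDiffOn_chart.contDiffAt (φ.chart.open_source.mem_nhds hx)

theorem contDiffAt_symm {x : Space} (hx : x ∈ φ.chart.target) : ContDiffAt ℝ ∞ φ.chart.symm x :=
  φ.contDiffOn_symm.contDiffAt (φ.chart.open_target.mem_nhds hx)

theorem eventually_mem_source : ∀ᶠ x in 𝓝 (0 : Space), x ∈ φ.chart.source :=
  φ.chart.open_source.mem_nhds φ.zero_mem_source

/-- The differential of the coordinates at the origin. -/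
theorem exists_hasFDerivAt : ∃ L : Space ≃L[ℝ] Space,
    HasFDerivAt φ.chart (L : Space →L[ℝ] Space) 0 ∧ ∀ v, (L v).2.2 = v.2.2 := by
  have h1 : HasFDerivAt φ.chart (fderiv ℝ φ.chart 0) 0 :=
    ((φ.contDiffAt_chart φ.zero_mem_source).differentiableAt (by simp)).hasFDerivAt
  have h2 : HasFDerivAt φ.chart.symm (fderiv ℝ φ.chart.symm 0) 0 :=
    ((φ.contDiffAt_symm φ.zero_mem_target).differentiableAt (by simp)).hasFDerivAt
  have h3 : HasFDerivAt (fun x => φ.chart.symm (φ.chart x)) _ 0 :=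
    HasFDerivAt.comp (g := φ.chart.symm) 0 (by rwa [φ.map_zero]) h1
  have h4 : HasFDerivAt (fun x => φ.chart.symm (φ.chart x)) (ContinuousLinearMap.id ℝ Space) 0 :=
    (hasFDerivAt_id _).congr_of_eventuallyEq
      (φ.eventually_mem_source.mono fun x hx => φ.chart.left_inv hx)
  have h5 := h3.unique h4
  -- The derivative of the inverse chart is a left inverse, by the chain rule, so the differential
  -- is injective.
  obtain ⟨L, hL⟩ := exists_continuousLinearEquiv_of_injective (fderiv ℝ φ.chart 0) (fun w hw => by
    have := congrArg (fun A : Space →L[ℝ] Space => A w) h5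
    simpa [hw] using this.symm)
  rw [← hL] at h1
  refine ⟨L, h1, fun v => ?_⟩
  let π : Space →L[ℝ] ℝ := (ContinuousLinearMap.snd ℝ ℝ ℝ).comp (ContinuousLinearMap.snd ℝ ℝ (ℝ × ℝ))
  have h6 : HasFDerivAt (fun x => π (φ.chart x)) (π.comp (L : Space →L[ℝ] Space)) 0 :=
    π.hasFDerivAt.comp 0 h1
  have h7 : HasFDerivAt (fun x => π (φ.chart x)) π 0 :=
    π.hasFDerivAt.congr_of_eventuallyEq (φ.eventually_mem_source.mono fun x hx =>
      φ.parameter_eq x hx)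
  exact congrArg (fun A : Space →L[ℝ] ℝ => A v) (h6.unique h7)

end SymplecticCoordinates

/-! ### The family in new coordinates -/

namespace SymplecticFamily

variable {F : SymplecticFamily}

theorem eventually_mem_domain : ∀ᶠ x in 𝓝 (0 : Space), x ∈ F.domain :=
  F.isOpen_domain.mem_nhds F.zero_mem_domain

theorem contDiffAt_toMap {x : Space} (hx : x ∈ F.domain) : ContDiffAt ℝ ∞ F.toMap x :=
  (F.contDiffOn_Q.contDiffAt (F.isOpen_domain.mem_nhds hx)).prodMk
    ((F.contDiffOn_P.contDiffAt (F.isOpen_domain.mem_nhds hx)).prodMk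
      (contDiffAt_snd.comp x contDiffAt_snd))

theorem toMap_eq_self_iff {x : Space} (hx : x ∈ F.domain) : F.toMap x = x ↔ x ∈ F.fixedPoints := by
  simp [toMap, fixedPoints, hx, Prod.ext_iff]

/-- The conjugated map in new coordinates. -/
noncomputable def conj (F : SymplecticFamily) (φ : SymplecticCoordinates) (y : Space) : Space :=
  φ.chart (F.toMap (φ.chart.symm y))

theorem toMap_zero (h0 : (0 : Space) ∈ F.fixedPoints) : F.toMap 0 = 0 :=
  (toMap_eq_self_iff h0.1).2 h0

theorem eventually_contDiffAt_conj (h0 : (0 : Space) ∈ F.fixedPoints) (φ : SymplecticCoordinates) :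
    ∀ᶠ y in 𝓝 0, ContDiffAt ℝ ∞ (F.conj φ) y := by
  have h1 : ∀ᶠ y in 𝓝 (0 : Space), y ∈ φ.chart.target :=
    φ.chart.open_target.mem_nhds φ.zero_mem_target
  have hs := (φ.contDiffAt_symm φ.zero_mem_target).continuousAt
  have h2 : ∀ᶠ y in 𝓝 (0 : Space), φ.chart.symm y ∈ F.domain :=
    hs.eventually (by rw [φ.symm_zero]; exact eventually_mem_domain)
  have hT : ContinuousAt (fun y => F.toMap (φ.chart.symm y)) 0 :=
    ContinuousAt.comp (g := F.toMap)
      (by rw [φ.symm_zero]; exact (contDiffAt_toMap h0.1).continuousAt) hs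
  have h3 : ∀ᶠ y in 𝓝 (0 : Space), F.toMap (φ.chart.symm y) ∈ φ.chart.source :=
    hT.eventually (by simpa only [φ.symm_zero, toMap_zero h0] using φ.eventually_mem_source)
  filter_upwards [h1, h2, h3] with y hy1 hy2 hy3
  exact ContDiffAt.comp (g := φ.chart) y (φ.contDiffAt_chart hy3)
    (ContDiffAt.comp (g := F.toMap) y (contDiffAt_toMap hy2) (φ.contDiffAt_symm hy1))

theorem conj_zero (h0 : (0 : Space) ∈ F.fixedPoints) (φ : SymplecticCoordinates) :
    F.conj φ 0 = 0 := by
  rw [conj, φ.symm_zero, toMap_zero h0, φ.map_zero]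

/-- Near the origin, `F.conj φ` is conjugate to `F.toMap`, and it keeps the parameter. -/
theorem eventually_conj_chart (h0 : (0 : Space) ∈ F.fixedPoints) (φ : SymplecticCoordinates) :
    ∀ᶠ x in 𝓝 0, x ∈ F.domain ∧ x ∈ φ.chart.source ∧ F.toMap x ∈ φ.chart.source ∧
      F.conj φ (φ.chart x) = φ.chart (F.toMap x) ∧
      (F.conj φ (φ.chart x)).2.2 = (φ.chart x).2.2 := by
  have h3 : ∀ᶠ x in 𝓝 (0 : Space), F.toMap x ∈ φ.chart.source :=
    (contDiffAt_toMap h0.1).continuousAt.eventually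
      (by rw [toMap_zero h0]; exact φ.eventually_mem_source)
  filter_upwards [eventually_mem_domain, φ.eventually_mem_source, h3] with x hx1 hx2 hx3
  have h : F.conj φ (φ.chart x) = φ.chart (F.toMap x) := by rw [conj, φ.chart.left_inv hx2]
  refine ⟨hx1, hx2, hx3, h, ?_⟩
  rw [h, φ.parameter_eq _ hx3, φ.parameter_eq _ hx2]
  rfl

/-- The function `Q - q` in new coordinates. -/
noncomputable def defectQ (F : SymplecticFamily) (φ : SymplecticCoordinates) (y : Space) : ℝ :=
  F.QIn φ y - y.1

/-- The function `P - p` in new coordinates. -/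
noncomputable def defectP (F : SymplecticFamily) (φ : SymplecticCoordinates) (y : Space) : ℝ :=
  F.PIn φ y - y.2.1

/-- The chart is injective and conjugates `F.toMap` to `F.conj φ`, hence matches their fixed points.
The parameter is preserved, so only the first two components impose conditions. -/
theorem eventually_mem_fixedPoints_iff (h0 : (0 : Space) ∈ F.fixedPoints)
    (φ : SymplecticCoordinates) :
    ∀ᶠ x in 𝓝 0, x ∈ F.fixedPoints ↔
      F.defectQ φ (φ.chart x) = 0 ∧ F.defectP φ (φ.chart x) = 0 := by
  filter_upwards [eventually_conj_chart h0 φ] with x ⟨hx1, hx2, hx3, h, h'⟩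
  rw [← toMap_eq_self_iff hx1, ← φ.chart.injOn.eq_iff hx3 hx2, ← h, defectQ, defectP, sub_eq_zero,
    sub_eq_zero]
  change _ ↔ (F.conj φ (φ.chart x)).1 = _ ∧ (F.conj φ (φ.chart x)).2.1 = _
  simp [Prod.ext_iff, h']

theorem eventually_contDiffAt_QIn (h0 : (0 : Space) ∈ F.fixedPoints) (φ : SymplecticCoordinates) :
    ∀ᶠ y in 𝓝 0, ContDiffAt ℝ ∞ (F.QIn φ) y :=
  (eventually_contDiffAt_conj h0 φ).mono fun y hy => contDiffAt_fst.comp y hy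

theorem eventually_contDiffAt_PIn (h0 : (0 : Space) ∈ F.fixedPoints) (φ : SymplecticCoordinates) :
    ∀ᶠ y in 𝓝 0, ContDiffAt ℝ ∞ (F.PIn φ) y :=
  (eventually_contDiffAt_conj h0 φ).mono fun y hy =>
    contDiffAt_fst.comp y (contDiffAt_snd.comp y hy)

theorem eventually_contDiffAt_defectQ (h0 : (0 : Space) ∈ F.fixedPoints)
    (φ : SymplecticCoordinates) : ∀ᶠ y in 𝓝 0, ContDiffAt ℝ ∞ (F.defectQ φ) y :=
  (eventually_contDiffAt_QIn h0 φ).mono fun _ hy => hy.sub contDiffAt_fst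

theorem eventually_contDiffAt_defectP (h0 : (0 : Space) ∈ F.fixedPoints)
    (φ : SymplecticCoordinates) : ∀ᶠ y in 𝓝 0, ContDiffAt ℝ ∞ (F.defectP φ) y :=
  (eventually_contDiffAt_PIn h0 φ).mono fun y hy =>
    hy.sub (contDiffAt_fst.comp y contDiffAt_snd)

theorem defectQ_zero (h0 : (0 : Space) ∈ F.fixedPoints) (φ : SymplecticCoordinates) :
    F.defectQ φ 0 = 0 := by
  change (F.conj φ 0).1 - 0 = 0
  rw [conj_zero h0]
  simp

theorem defectP_zero (h0 : (0 : Space) ∈ F.fixedPoints) (φ : SymplecticCoordinates) :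
    F.defectP φ 0 = 0 := by
  change (F.conj φ 0).2.1 - 0 = 0
  rw [conj_zero h0]
  simp

theorem fderiv_defectQ {φ : SymplecticCoordinates} {y : Space}
    (hy : DifferentiableAt ℝ (F.QIn φ) y) (w : Space) :
    fderiv ℝ (F.defectQ φ) y w = fderiv ℝ (F.QIn φ) y w - w.1 := by
  have h : HasFDerivAt (F.defectQ φ) (fderiv ℝ (F.QIn φ) y - ContinuousLinearMap.fst ℝ ℝ (ℝ × ℝ)) y :=
    hy.hasFDerivAt.sub hasFDerivAt_fst
  rw [h.fderiv]
  rfl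

theorem fderiv_defectP {φ : SymplecticCoordinates} {y : Space}
    (hy : DifferentiableAt ℝ (F.PIn φ) y) :
    fderiv ℝ (F.defectP φ) y = fderiv ℝ (F.PIn φ) y -
      (ContinuousLinearMap.fst ℝ ℝ ℝ).comp (ContinuousLinearMap.snd ℝ ℝ (ℝ × ℝ)) :=
  (hy.hasFDerivAt.sub (hasFDerivAt_fst.comp y hasFDerivAt_snd)).fderiv

/-! ### The Hessian in new coordinates and the sign of its determinant -/

theorem fderiv_fderiv_defectP (h0 : (0 : Space) ∈ F.fixedPoints) (φ : SymplecticCoordinates) :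
    fderiv ℝ (fderiv ℝ (F.defectP φ)) 0 = fderiv ℝ (fderiv ℝ (F.PIn φ)) 0 := by
  have h : fderiv ℝ (F.defectP φ) =ᶠ[𝓝 0] fun y => fderiv ℝ (F.PIn φ) y -
      (ContinuousLinearMap.fst ℝ ℝ ℝ).comp (ContinuousLinearMap.snd ℝ ℝ (ℝ × ℝ)) := by
    filter_upwards [eventually_contDiffAt_PIn h0 φ] with y hy
    exact fderiv_defectP (hy.differentiableAt (by simp))
  rw [h.fderiv_eq, fderiv_sub_const]

theorem hessianIn_eq (h0 : (0 : Space) ∈ F.fixedPoints) (φ : SymplecticCoordinates) :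
    F.hessianIn φ =
      !![fderiv ℝ (fderiv ℝ (F.defectP φ)) 0 (1, 0, 0) (1, 0, 0),
         fderiv ℝ (fderiv ℝ (F.defectP φ)) 0 (0, 0, 1) (1, 0, 0);
         fderiv ℝ (fderiv ℝ (F.defectP φ)) 0 (1, 0, 0) (0, 0, 1),
         fderiv ℝ (fderiv ℝ (F.defectP φ)) 0 (0, 0, 1) (0, 0, 1)] := by
  have hP := (eventually_contDiffAt_PIn h0 φ).self_of_nhds
  simp only [fderiv_fderiv_defectP h0 φ, ← fderiv_fderiv_apply hP]
  rfl

theorem dq_dq_PIn (h0 : (0 : Space) ∈ F.fixedPoints) (φ : SymplecticCoordinates) :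
    dq (dq (F.PIn φ)) 0 = fderiv ℝ (fderiv ℝ (F.defectP φ)) 0 (1, 0, 0) (1, 0, 0) := by
  rw [fderiv_fderiv_defectP h0 φ,
    ← fderiv_fderiv_apply (eventually_contDiffAt_PIn h0 φ).self_of_nhds]
  rfl

theorem det_hessianIn (h0 : (0 : Space) ∈ F.fixedPoints) (φ : SymplecticCoordinates) :
    (F.hessianIn φ).det = fderiv ℝ (fderiv ℝ (F.defectP φ)) 0 (1, 0, 0) (1, 0, 0) *
        fderiv ℝ (fderiv ℝ (F.defectP φ)) 0 (0, 0, 1) (0, 0, 1) -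
      fderiv ℝ (fderiv ℝ (F.defectP φ)) 0 (1, 0, 0) (0, 0, 1) *
        fderiv ℝ (fderiv ℝ (F.defectP φ)) 0 (0, 0, 1) (1, 0, 0) := by
  rw [hessianIn_eq h0, Matrix.det_fin_two_of]
  ring

theorem det_pos_of_isDefiniteMatrix {M : Matrix (Fin 2) (Fin 2) ℝ} (h : IsDefiniteMatrix M) :
    0 < M.det := by
  rcases h with h | h
  · exact h.det_pos
  · simpa [Matrix.det_neg] using h.det_pos

/-- If the determinant were positive, completing the square would make `M 0 0` times the quadratic
form nonnegative. As the form takes both signs, `M 0 0 = 0`, and then the determinant is `-(M 1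
0)²`, a contradiction. -/
theorem det_neg_of_isIndefiniteMatrix {M : Matrix (Fin 2) (Fin 2) ℝ} (hs : M 0 1 = M 1 0)
    (hdet : M.det ≠ 0) (h : IsIndefiniteMatrix M) : M.det < 0 := by
  by_contra hneg
  have hpos : 0 < M.det := lt_of_le_of_ne (not_lt.1 hneg) hdet.symm
  obtain ⟨⟨v, hv⟩, w, hw⟩ := h
  rw [Matrix.det_fin_two] at hpos
  simp only [Matrix.mulVec, dotProduct, Fin.sum_univ_two] at hv hw
  rw [hs] at hv hw hpos
  have key : ∀ u : Fin 2 → ℝ, 0 ≤ M 0 0 * (u 0 * (M 0 0 * u 0 + M 1 0 * u 1) +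
      u 1 * (M 1 0 * u 0 + M 1 1 * u 1)) := by
    intro u
    have : M 0 0 * (u 0 * (M 0 0 * u 0 + M 1 0 * u 1) + u 1 * (M 1 0 * u 0 + M 1 1 * u 1)) =
        (M 0 0 * u 0 + M 1 0 * u 1) ^ 2 + (M 0 0 * M 1 1 - M 1 0 * M 1 0) * u 1 ^ 2 := by ring
    rw [this]
    positivity
  have h1 : 0 ≤ M 0 0 := nonneg_of_mul_nonneg_left (key v) hv
  have h2 : M 0 0 ≤ 0 := nonpos_of_mul_nonneg_left (key w) hw
  have h3 : M 0 0 = 0 := le_antisymm h2 h1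
  rw [h3] at hpos
  nlinarith [mul_self_nonneg (M 1 0)]

theorem det_hessianIn_neg (h0 : (0 : Space) ∈ F.fixedPoints) {φ : SymplecticCoordinates}
    (hdet : (F.hessianIn φ).det ≠ 0) (h : IsIndefiniteMatrix (F.hessianIn φ)) :
    (F.hessianIn φ).det < 0 := by
  refine det_neg_of_isIndefiniteMatrix ?_ hdet h
  rw [hessianIn_eq h0]
  have hsymm : IsSymmSndFDerivAt ℝ (F.defectP φ) 0 :=
    (eventually_contDiffAt_defectP h0 φ).self_of_nhds.isSymmSndFDerivAt
      (by rw [minSmoothness_of_isRCLikeNormedField]; norm_cast)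
  exact hsymm.eq _ _

/-! ### Adapted coordinates, the eigenspace and `P_qq` -/

/-- The differentials of `Q - q` and `P - p` at the origin in adapted coordinates. -/
theorem IsAdapted.fderiv_defect (h0 : (0 : Space) ∈ F.fixedPoints) {φ : SymplecticCoordinates}
    (hφ : F.IsAdapted φ) : ∃ c : ℝ, c ≠ 0 ∧
      (∀ w, fderiv ℝ (F.defectQ φ) 0 w = c * w.2.1) ∧ fderiv ℝ (F.defectP φ) 0 = 0 := by
  obtain ⟨c, hc, h⟩ := hφ
  have e : ∀ i j, _ := fun i j => congrFun (congrFun h i) j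
  have e00 := e 0 0
  have e01 := e 0 1
  have e02 := e 0 2
  have e10 := e 1 0
  have e11 := e 1 1
  have e12 := e 1 2
  simp [fixedPointJacobian] at e00 e01 e02 e10 e11 e12
  refine ⟨c, hc, fun w => ?_, ?_⟩
  · rw [fderiv_defectQ ((eventually_contDiffAt_QIn h0 φ).self_of_nhds.differentiableAt (by simp)),
      fderiv_apply_eq, e01, e02]
    linear_combination w.1 * e00
  · refine ContinuousLinearMap.ext fun w => ?_
    rw [fderiv_defectP ((eventually_contDiffAt_PIn h0 φ).self_of_nhds.differentiableAt (by simp))]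
    change fderiv ℝ (F.PIn φ) 0 w - w.2.1 = 0
    rw [fderiv_apply_eq, e10, e12]
    linear_combination w.2.1 * e11

/-- On the plane `ε = 0` the `ε`-derivatives drop out. Fixed vectors of the full differential are
convenient because the chain rule transports them through a conjugation. -/
theorem mem_eigenspace_iff (h0 : (0 : Space) ∈ F.fixedPoints) (v : Space) :
    v ∈ F.eigenspace ↔ v.2.2 = 0 ∧ fderiv ℝ F.toMap 0 v = v := by
  have hQ : HasFDerivAt F.Q (fderiv ℝ F.Q 0) 0 :=
    ((F.contDiffOn_Q.contDiffAt (F.isOpen_domain.mem_nhds h0.1)).differentiableAt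
      (by simp)).hasFDerivAt
  have hP : HasFDerivAt F.P (fderiv ℝ F.P 0) 0 :=
    ((F.contDiffOn_P.contDiffAt (F.isOpen_domain.mem_nhds h0.1)).differentiableAt
      (by simp)).hasFDerivAt
  have hT : HasFDerivAt F.toMap _ 0 :=
    hQ.prodMk (hP.prodMk (hasFDerivAt_snd.comp (0 : Space) hasFDerivAt_snd))
  have hTv : fderiv ℝ F.toMap 0 v = (fderiv ℝ F.Q 0 v, fderiv ℝ F.P 0 v, v.2.2) := by
    rw [hT.fderiv]
    rfl
  rw [hTv, fderiv_apply_eq, fderiv_apply_eq]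
  have hJ : ∀ u : Fin 2 → ℝ, Matrix.toLin' F.jacobianAtZero u =
      ![dq F.Q 0 * u 0 + dp F.Q 0 * u 1, dq F.P 0 * u 0 + dp F.P 0 * u 1] := by
    intro u
    ext i
    fin_cases i <;> simp [jacobianAtZero, jacobian, Matrix.mulVec, dotProduct, Fin.sum_univ_two]
  simp only [eigenspace, Submodule.mem_map, Module.End.mem_eigenspace_iff, one_smul, hJ]
  constructor
  · rintro ⟨u, hu, rfl⟩
    have hu0 := congrFun hu 0
    have hu1 := congrFun hu 1
    simp only [Matrix.cons_val_zero, Matrix.cons_val_one] at hu0 hu1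
    refine ⟨rfl, Prod.ext ?_ (Prod.ext ?_ rfl)⟩
    · change u 0 * dq F.Q 0 + u 1 * dp F.Q 0 + 0 * dε F.Q 0 = u 0
      linear_combination hu0
    · change u 0 * dq F.P 0 + u 1 * dp F.P 0 + 0 * dε F.P 0 = u 1
      linear_combination hu1
  · rintro ⟨h, hv⟩
    have hv0 := congrArg (fun w : Space => w.1) hv
    have hv1 := congrArg (fun w : Space => w.2.1) hv
    simp only [h, zero_mul, add_zero] at hv0 hv1
    refine ⟨![v.1, v.2.1], ?_, Prod.ext rfl (Prod.ext rfl h.symm)⟩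
    ext i
    fin_cases i
    · simpa [mul_comm] using hv0
    · simpa [mul_comm] using hv1

/-- In adapted coordinates, the eigenspace is the `q`-axis. -/
theorem mem_eigenspace_iff_of_isAdapted (h0 : (0 : Space) ∈ F.fixedPoints)
    {φ : SymplecticCoordinates} (hφ : F.IsAdapted φ) {L : Space ≃L[ℝ] Space}
    (hL : HasFDerivAt φ.chart (L : Space →L[ℝ] Space) 0) (hL' : ∀ v, (L v).2.2 = v.2.2)
    (v : Space) : v ∈ F.eigenspace ↔ (L v).2 = 0 := by
  obtain ⟨c, hc, hQ, hP⟩ := hφ.fderiv_defect h0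
  have hK : HasFDerivAt (F.conj φ) (fderiv ℝ (F.conj φ) 0) 0 :=
    ((eventually_contDiffAt_conj h0 φ).self_of_nhds.differentiableAt (by simp)).hasFDerivAt
  have hT : HasFDerivAt F.toMap (fderiv ℝ F.toMap 0) 0 :=
    ((contDiffAt_toMap h0.1).differentiableAt (by simp)).hasFDerivAt
  have h1 : HasFDerivAt (fun x => F.conj φ (φ.chart x)) _ 0 :=
    HasFDerivAt.comp (g := F.conj φ) 0 (by rwa [φ.map_zero]) hL
  have h2 : HasFDerivAt (fun x => φ.chart (F.toMap x)) _ 0 :=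
    HasFDerivAt.comp (g := φ.chart) 0 (by rwa [toMap_zero h0]) hT
  have h3 : fderiv ℝ (F.conj φ) 0 (L v) = L (fderiv ℝ F.toMap 0 v) :=
    congrArg (fun A : Space →L[ℝ] Space => A v)
      (h1.unique (h2.congr_of_eventuallyEq ((eventually_conj_chart h0 φ).mono fun x hx => hx.2.2.2.1)))
  have hQ1 : fderiv ℝ (F.QIn φ) 0 (L v) = (fderiv ℝ (F.conj φ) 0 (L v)).1 := by
    have : HasFDerivAt (F.QIn φ) _ 0 := hasFDerivAt_fst.comp (0 : Space) hK
    rw [this.fderiv]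
    rfl
  have hP1 : fderiv ℝ (F.PIn φ) 0 (L v) = (fderiv ℝ (F.conj φ) 0 (L v)).2.1 := by
    have : HasFDerivAt (F.PIn φ) _ 0 :=
      hasFDerivAt_fst.comp (0 : Space) (hasFDerivAt_snd.comp (0 : Space) hK)
    rw [this.fderiv]
    rfl
  have hQ2 := hQ (L v)
  rw [fderiv_defectQ ((eventually_contDiffAt_QIn h0 φ).self_of_nhds.differentiableAt (by simp)),
    hQ1, h3] at hQ2
  have hP2 : (L (fderiv ℝ F.toMap 0 v)).2.1 - (L v).2.1 = 0 := by
    rw [← h3, ← hP1]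
    have := congrArg (fun A : Space →L[ℝ] ℝ => A (L v)) hP
    rwa [fderiv_defectP
      ((eventually_contDiffAt_PIn h0 φ).self_of_nhds.differentiableAt (by simp))] at this
  have hT2 : (fderiv ℝ F.toMap 0 v).2.2 = v.2.2 := by
    have h4 : HasFDerivAt (fun x => (F.toMap x).2.2) _ 0 := hT.snd.snd
    have h5 := ((ContinuousLinearMap.snd ℝ ℝ ℝ).comp
      (ContinuousLinearMap.snd ℝ ℝ (ℝ × ℝ))).hasFDerivAt (x := (0 : Space))
    exact congrArg (fun A : Space →L[ℝ] ℝ => A v) (h4.unique h5)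
  -- Of the three components of the fixed vector equation, those in `p` and `ε` hold automatically;
  -- by `hQ2` the one in `q` says `c * (L v).2.1 = 0`.
  rw [mem_eigenspace_iff h0, ← L.injective.eq_iff, Prod.ext_iff, Prod.ext_iff, Prod.ext_iff, hL',
    hL', hT2, sub_eq_zero.1 hP2]
  constructor
  · rintro ⟨h, h', -⟩
    rw [h', sub_self] at hQ2
    exact ⟨(mul_eq_zero.1 hQ2.symm).resolve_left hc, h⟩
  · rintro ⟨h, h'⟩
    have h6 : (L v).2.1 = 0 := h
    rw [h6, mul_zero, sub_eq_zero] at hQ2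
    exact ⟨h', hQ2, rfl, rfl⟩

/-- If a curve of fixed points has a nonzero velocity in the eigenspace, then `P_qq` vanishes in
adapted coordinates. -/
theorem dq_dq_PIn_eq_zero_of_curve (h0 : (0 : Space) ∈ F.fixedPoints) {φ : SymplecticCoordinates}
    (hφ : F.IsAdapted φ) {γ : ℝ → Space} {v : Space} (hγs : ContDiffAt ℝ ∞ γ 0) (hγ0 : γ 0 = 0)
    (hγF : ∀ᶠ t in 𝓝 (0 : ℝ), γ t ∈ F.fixedPoints) (hγ : HasDerivAt γ v 0)
    (hv : v ∈ F.eigenspace) (hv0 : v ≠ 0) : dq (dq (F.PIn φ)) 0 = 0 := by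
  obtain ⟨L, hL, hL'⟩ := φ.exists_hasFDerivAt
  obtain ⟨c, hc, hQ, hP⟩ := hφ.fderiv_defect h0
  rw [mem_eigenspace_iff_of_isAdapted h0 hφ hL hL'] at hv
  set κ : ℝ → Space := fun t => φ.chart (γ t) with hκ
  have hκ0 : κ 0 = 0 := by simp only [hκ, hγ0, φ.map_zero]
  have hκs : ContDiffAt ℝ ∞ κ 0 :=
    ContDiffAt.comp (g := φ.chart) 0 (by rw [hγ0]; exact φ.contDiffAt_chart φ.zero_mem_source) hγs
  have hκd : HasDerivAt κ (L v) 0 :=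
    HasFDerivAt.comp_hasDerivAt (l := φ.chart) (l' := (L : Space →L[ℝ] Space)) 0 (by rwa [hγ0]) hγ
  have hz : F.defectP φ ∘ κ =ᶠ[𝓝 0] fun _ => 0 := by
    have h1 := hγs.continuousAt.eventually (p := fun x => x ∈ F.fixedPoints ↔
      F.defectQ φ (φ.chart x) = 0 ∧ F.defectP φ (φ.chart x) = 0)
      (by rw [hγ0]; exact eventually_mem_fixedPoints_iff h0 φ)
    filter_upwards [h1, hγF] with t h h'
    exact (h.1 h').2
  -- `P - p` vanishes along the curve and is critical at the origin. Its velocity there lies on the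
  -- `q`-axis, so two differentiations leave `(L v).1² P_qq = 0`.
  have h2 := fderiv_fderiv_comp_of_fderiv_eq_zero (f := F.defectP φ) (κ := κ) (x := 0)
    (by rw [hκ0]; exact (eventually_contDiffAt_defectP h0 φ).self_of_nhds.of_le (by norm_cast))
    (hκs.of_le (by norm_cast)) (by rw [hκ0, hP]) 1 1
  have h3 : fderiv ℝ κ 0 1 = (L v).1 • ((1, 0, 0) : Space) := by
    rw [hκd.hasFDerivAt.fderiv]
    ext <;> simp [hv]
  have h4 : (L v).1 ≠ 0 := fun h => hv0 (L.injective (by rw [map_zero]; exact Prod.ext h hv))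
  rw [hz.fderiv.fderiv_eq, hκ0, h3] at h2
  simp only [map_smul, smul_apply, smul_eq_mul, fderiv_fun_const] at h2
  rw [dq_dq_PIn h0]
  have h5 : (L v).1 * ((L v).1 *
      fderiv ℝ (fderiv ℝ (F.defectP φ)) 0 (1, 0, 0) (1, 0, 0)) = 0 := by
    rw [← h2, fderiv_zero]
    simp
  exact (mul_eq_zero.1 ((mul_eq_zero.1 h5).resolve_left h4)).resolve_left h4

/-! ### The definite case and the cross-bifurcation -/

theorem exists_isolated_of_isDefinite (h : F.IsDefinite) :
    ∃ U : Set Space, IsOpen U ∧ 0 ∈ U ∧ U ⊆ F.domain ∧ F.fixedPoints ∩ U = {0} := by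
  obtain ⟨hr, φ, hφ, -, hdef⟩ := h
  have h0 := hr.map_zero
  obtain ⟨c, hc, hQ, hP⟩ := hφ.fderiv_defect h0
  have hdet := det_pos_of_isDefiniteMatrix hdef
  rw [det_hessianIn h0] at hdet
  have h1 := eventually_eq_zero_of_definite hc (eventually_contDiffAt_defectQ h0 φ)
    (eventually_contDiffAt_defectP h0 φ) (defectQ_zero h0 φ) (defectP_zero h0 φ) hQ hP hdet
  have h2 := (φ.contDiffAt_chart φ.zero_mem_source).continuousAt.eventually
    (p := fun y => F.defectQ φ y = 0 → F.defectP φ y = 0 → y = 0) (by rwa [φ.map_zero])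
  obtain ⟨U, hU, hUo, h0U⟩ := eventually_nhds_iff.1 ((h2.and
    (eventually_mem_fixedPoints_iff h0 φ)).and (eventually_mem_domain.and φ.eventually_mem_source))
  refine ⟨U, hUo, h0U, fun x hx => (hU x hx).2.1, ?_⟩
  ext x
  refine ⟨fun ⟨hx, hxU⟩ => ?_, fun hx => ?_⟩
  · obtain ⟨⟨h3, h4⟩, -, h5⟩ := hU x hxU
    have h6 := h4.1 hx
    exact φ.chart.injOn h5 φ.zero_mem_source ((h3 h6.1 h6.2).trans φ.map_zero.symm)
  · rw [mem_singleton_iff] at hx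
    rw [hx]
    exact ⟨h0, h0U⟩

/-- A chart near the origin straightening the fixed point set to two coordinate axes. -/
theorem exists_chart_fixedPoints (h0 : (0 : Space) ∈ F.fixedPoints) {φ : SymplecticCoordinates}
    (hφ : F.IsAdapted φ) (hdet : (F.hessianIn φ).det < 0) {L : Space ≃L[ℝ] Space}
    (hL : HasFDerivAt φ.chart (L : Space →L[ℝ] Space) 0) :
    ∃ (Θ : OpenPartialHomeomorph Space Space) (N : Space ≃L[ℝ] Space) (c : ℝ), c ≠ 0 ∧
      (0 : Space) ∈ Θ.source ∧ Θ.source ⊆ F.domain ∧ Θ 0 = 0 ∧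
      ContDiffOn ℝ ∞ Θ Θ.source ∧ ContDiffOn ℝ ∞ Θ.symm Θ.target ∧
      HasFDerivAt Θ (N : Space →L[ℝ] Space) 0 ∧ (∀ v, (N v).2.2 = c * (L v).2.1) ∧
      (∀ x ∈ Θ.source, x ∈ F.fixedPoints ↔ ((Θ x).1 = 0 ∨ (Θ x).2.1 = 0) ∧ (Θ x).2.2 = 0) ∧
      (dq (dq (F.PIn φ)) 0 = 0 → ∀ v, (L v).2 = 0 → (N v).1 = 0) := by
  obtain ⟨c, hc, hQ, hP⟩ := hφ.fderiv_defect h0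
  rw [det_hessianIn h0] at hdet
  obtain ⟨e, M, h0e, -, e0, hes, het, hM, hM2, hz, hqq⟩ := exists_chart_of_indefinite hc
    (eventually_contDiffAt_defectQ h0 φ) (eventually_contDiffAt_defectP h0 φ) (defectQ_zero h0 φ)
    (defectP_zero h0 φ) hQ hP hdet univ_mem
  obtain ⟨V, hV, hVo, h0V⟩ := eventually_nhds_iff.1
    ((eventually_mem_fixedPoints_iff h0 φ).and eventually_mem_domain)
  -- The restriction to `V` makes the fixed point criterion available at every point of the source.
  let Ψ : OpenPartialHomeomorph Space Space := φ.chart.restrOpen V hVo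
  have hΨs : ∀ x ∈ (Ψ.trans e).source, x ∈ φ.chart.source ∧ x ∈ V ∧ φ.chart x ∈ e.source :=
    fun x hx => ⟨hx.1.1, hx.1.2, hx.2⟩
  have hΨt : ∀ y ∈ (Ψ.trans e).target, y ∈ e.target ∧ e.symm y ∈ φ.chart.target :=
    fun y hy => ⟨hy.1, hy.2.1⟩
  refine ⟨Ψ.trans e, L.trans M, c, hc, ⟨⟨φ.zero_mem_source, h0V⟩, ?_⟩,
    fun x hx => (hV x (hΨs x hx).2.1).2, ?_, ?_, ?_, ?_, fun v => hM2 (L v), ?_, ?_⟩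
  · change φ.chart 0 ∈ e.source
    rwa [φ.map_zero]
  · change e (φ.chart 0) = 0
    rw [φ.map_zero, e0]
  · exact hes.comp (φ.contDiffOn_chart.mono fun x hx => (hΨs x hx).1) fun x hx => (hΨs x hx).2.2
  · exact φ.contDiffOn_symm.comp (het.mono fun y hy => (hΨt y hy).1) fun y hy => (hΨt y hy).2
  · exact HasFDerivAt.comp (g := e) (g' := (M : Space →L[ℝ] Space)) 0 (by rwa [φ.map_zero]) hL
  · intro x hx
    obtain ⟨-, hxV, hxe⟩ := hΨs x hx
    exact (hV x hxV).1.trans (hz _ hxe)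
  · intro h v hv
    rw [dq_dq_PIn h0] at h
    have : L v = ((L v).1, 0, 0) := Prod.ext rfl hv
    change (M (L v)).1 = 0
    rw [this]
    exact hqq h _

theorem exists_curves_of_isCross (h : F.IsCross) :
    ∃ U A B : Set Space, IsOpen U ∧ 0 ∈ U ∧ U ⊆ F.domain ∧
      F.fixedPoints ∩ U = A ∪ B ∧ IsSmoothCurve A ∧ IsSmoothCurve B ∧ A ∩ B = {0} ∧
      Module.finrank ℝ (tangentAt A 0) = 1 ∧ Module.finrank ℝ (tangentAt B 0) = 1 ∧
      tangentAt A 0 ≠ tangentAt B 0 ∧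
      (tangentAt A 0 ⊔ tangentAt B 0) ⊓ parameterZeroPlane = F.eigenspace ∧
      Module.finrank ℝ F.eigenspace = 1 ∧
      (F.IsTranscritical ↔ F.eigenspace ≠ tangentAt A 0 ∧ F.eigenspace ≠ tangentAt B 0) := by
  obtain ⟨hr, φ, hφ, hdet, hind⟩ := h
  have h0 := hr.map_zero
  obtain ⟨L, hL, hL'⟩ := φ.exists_hasFDerivAt
  obtain ⟨Θ, N, c, hc, h0Θ, hΘd, hΘ0, hΘs, hΘt, hN, hN2, hz, hqq⟩ :=
    exists_chart_fixedPoints h0 hφ (det_hessianIn_neg h0 hdet hind) hL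
  -- The second branch is the second chart axis; the exchange turns it into the first, so the
  -- results on curves apply to both branches.
  let Θ' := Θ.transHomeomorph swapQP.toHomeomorph
  have hΘ's : ContDiffOn ℝ ∞ Θ' Θ'.source := swapQP.contDiff.comp_contDiffOn hΘs
  have hΘ't : ContDiffOn ℝ ∞ Θ'.symm Θ'.target :=
    hΘt.comp swapQP.symm.contDiff.contDiffOn fun y hy => hy
  have hN' : HasFDerivAt Θ' ((N.trans swapQP : Space ≃L[ℝ] Space) : Space →L[ℝ] Space) 0 :=
    HasFDerivAt.comp (g := swapQP) (g' := (swapQP : Space →L[ℝ] Space)) 0 swapQP.hasFDerivAt hN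
  have hΘ'0 : Θ' 0 = 0 := by
    change swapQP (Θ 0) = 0
    rw [hΘ0, map_zero]
  set A : Set Space := {x | x ∈ Θ.source ∧ (Θ x).2 = 0} with hA
  set B : Set Space := {x | x ∈ Θ'.source ∧ (Θ' x).2 = 0} with hB
  have hΘ'2 : ∀ x, (Θ' x).2 = ((Θ x).1, (Θ x).2.2) := fun _ => rfl
  have hΘ'src : Θ'.source = Θ.source := rfl
  have hunion : F.fixedPoints ∩ Θ.source = A ∪ B := by
    ext x
    simp only [hA, hB, mem_inter_iff, mem_union, mem_ofPred_eq, hΘ'2, hΘ'src, Prod.ext_iff,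
      Prod.fst_zero, Prod.snd_zero]
    constructor
    · rintro ⟨hx, hxs⟩
      have := (hz x hxs).1 hx
      tauto
    · intro hx
      have hxs : x ∈ Θ.source := hx.elim And.left And.left
      have := hz x hxs
      tauto
  have htA : tangentAt A 0 = _ := tangentAt_eq_span h0Θ hΘ0 hΘt hN
  have htB : tangentAt B 0 = _ := tangentAt_eq_span (Θ := Θ') h0Θ hΘ'0 hΘ't hN'
  have hmA : ∀ v, v ∈ tangentAt A 0 ↔ (N v).2 = 0 := fun v => by rw [htA, mem_span_symm_iff]
  have hmB : ∀ v, v ∈ tangentAt B 0 ↔ (N v).1 = 0 ∧ (N v).2.2 = 0 := fun v => by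
    rw [htB, mem_span_symm_iff]
    exact Prod.mk_eq_zero
  have hmE : ∀ v, v ∈ F.eigenspace ↔ (L v).2 = 0 := mem_eigenspace_iff_of_isAdapted h0 hφ hL hL'
  have hE : F.eigenspace = Submodule.span ℝ {L.symm (1, 0, 0)} := by
    ext v
    rw [hmE, mem_span_symm_iff]
  have hfA : Module.finrank ℝ (tangentAt A 0) = 1 := by rw [htA, finrank_span_symm]
  have hfB : Module.finrank ℝ (tangentAt B 0) = 1 := by rw [htB, finrank_span_symm]
  have hfE : Module.finrank ℝ F.eigenspace = 1 := by rw [hE, finrank_span_symm]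
  -- If `P_qq` were nonzero, every velocity spanning the tangent line would be zero, contradicting
  -- that the eigenspace has dimension one. All adapted `ψ` are covered, since a transcritical
  -- bifurcation comes with coordinates of its own.
  have hcurve : ∀ C : Set Space, C ⊆ F.fixedPoints → F.eigenspace = tangentAt C 0 →
      ∀ ψ, F.IsAdapted ψ → dq (dq (F.PIn ψ)) 0 = 0 := by
    intro C hC hEC ψ hψ
    by_contra hne
    have hbot : tangentAt C 0 ≤ ⊥ := by
      refine Submodule.span_le.2 fun v hv => ?_
      have hvE : v ∈ F.eigenspace := by rw [hEC]; exact Submodule.subset_span hv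
      obtain ⟨γ, hγs, hγ0, hγC, hγ⟩ := hv
      by_contra hv0
      exact hne (dq_dq_PIn_eq_zero_of_curve h0 hψ hγs hγ0 (hγC.mono fun t ht => hC ht) hγ hvE hv0)
    rw [hEC, le_bot_iff.1 hbot, finrank_bot] at hfE
    exact zero_ne_one hfE
  have hAF : A ⊆ F.fixedPoints := fun x hx => (hunion.ge (Or.inl hx)).1
  have hBF : B ⊆ F.fixedPoints := fun x hx => (hunion.ge (Or.inr hx)).1
  refine ⟨Θ.source, A, B, Θ.open_source, h0Θ, hΘd, hunion, isSmoothCurve_of_chart hΘs hΘt,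
    isSmoothCurve_of_chart hΘ's hΘ't, ?_, hfA, hfB, ?_, ?_, hfE, ?_, ?_⟩
  · ext x
    rw [mem_singleton_iff]
    constructor
    · rintro ⟨⟨hxs, hx⟩, -, hx'⟩
      refine Θ.injOn hxs h0Θ ?_
      rw [hΘ0]
      exact Prod.ext (Prod.mk_eq_zero.1 hx').1 hx
    · rintro rfl
      exact ⟨⟨h0Θ, by rw [hΘ0]; rfl⟩, h0Θ, by rw [hΘ'0]; rfl⟩
  · intro hAB
    have h1 : N.symm (1, 0, 0) ∈ tangentAt B 0 := by
      rw [← hAB, hmA]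
      simp
    have h2 := ((hmB _).1 h1).1
    simp at h2
  · ext v
    rw [Submodule.mem_inf, hmE]
    have hε : v ∈ parameterZeroPlane ↔ (L v).2.2 = 0 := by rw [hL']; rfl
    -- The two lines span the plane of the first two chart coordinates, where the third, `c` times
    -- the adapted `p`-component, vanishes.
    have hsup : v ∈ tangentAt A 0 ⊔ tangentAt B 0 ↔ (L v).2.1 = 0 := by
      have : (L v).2.1 = 0 ↔ (N v).2.2 = 0 := by simp [hN2, hc]
      rw [this]
      constructor
      · intro hv
        obtain ⟨a, ha, b, hb, rfl⟩ := Submodule.mem_sup.1 hv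
        rw [hmA] at ha
        rw [hmB] at hb
        rw [map_add, Prod.snd_add, Prod.snd_add, ha, hb.2]
        simp
      · intro hv
        refine Submodule.mem_sup.2 ⟨N.symm ((N v).1, 0, 0), by simp [hmA],
          N.symm (0, (N v).2.1, 0), by simp [hmB], ?_⟩
        rw [← map_add, N.symm_apply_eq]
        ext <;> simp [hv]
    rw [hε, hsup]
    exact (@Prod.ext_iff _ _ (L v).2 0).symm
  · rintro ⟨-, ψ, hψ, -, -, hne⟩
    exact ⟨fun h => hne (hcurve A hAF h ψ hψ), fun h => hne (hcurve B hBF h ψ hψ)⟩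
  · rintro ⟨-, hneB⟩
    -- `B` is the branch `α = 0`. When `P_qq = 0`, the differential of `α` has no `q`-term, so the
    -- eigenspace lies in the tangent line of `B` and equals it by dimension.
    refine ⟨hr, φ, hφ, hdet, hind, fun h => hneB ?_⟩
    refine Submodule.eq_of_le_of_finrank_eq (fun v hv => ?_) (hfE.trans hfB.symm)
    rw [hmE] at hv
    rw [hmB, hN2, hv]
    exact ⟨hqq h v hv, by simp⟩

end SymplecticFamily

end SymplecticBifurcation

end

theorem proposition1 (F : SymplecticBifurcation.SymplecticFamily) (hF : F.IsRegular) :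
    (F.IsDefinite →
      ∃ U : Set SymplecticBifurcation.Space, IsOpen U ∧ 0 ∈ U ∧ U ⊆ F.domain ∧
        F.fixedPoints ∩ U = {0}) ∧
    (F.IsCross →
      ∃ U A B : Set SymplecticBifurcation.Space, IsOpen U ∧ 0 ∈ U ∧ U ⊆ F.domain ∧
        F.fixedPoints ∩ U = A ∪ B ∧
        SymplecticBifurcation.IsSmoothCurve A ∧ SymplecticBifurcation.IsSmoothCurve B ∧
        A ∩ B = {0} ∧
        Module.finrank ℝ (SymplecticBifurcation.tangentAt A 0) = 1 ∧
        Module.finrank ℝ (SymplecticBifurcation.tangentAt B 0) = 1 ∧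
        SymplecticBifurcation.tangentAt A 0 ≠ SymplecticBifurcation.tangentAt B 0 ∧
        (SymplecticBifurcation.tangentAt A 0 ⊔ SymplecticBifurcation.tangentAt B 0) ⊓
          SymplecticBifurcation.parameterZeroPlane = F.eigenspace ∧
        Module.finrank ℝ F.eigenspace = 1 ∧
        (F.IsTranscritical ↔
          F.eigenspace ≠ SymplecticBifurcation.tangentAt A 0 ∧
          F.eigenspace ≠ SymplecticBifurcation.tangentAt B 0)) := by
  exact ⟨SymplecticBifurcation.SymplecticFamily.exists_isolated_of_isDefinite,
    SymplecticBifurcation.SymplecticFamily.exists_curves_of_isCross⟩
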